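/- Let $n\ge 2$, let $s\ge 2$, $a\in(0,1)$, $q\in(\frac n2,n]$, and let $(M^n,g,k)$ be a $C^{s,a}_{-q}$-asymptotically Anti-de Sitter (AdS) initial data set: $(M,g)$ is a complete connected Riemannian manifold without boundary, $k$ is a symmetric two-tensor, the complement of a compact set is a finite disjoint union of ends, each of them identified by a diffeomorphism with the complement of a ball in hyperbolic space $(\mathbb H^n,b)$, on each end $g-b$ lies in the weighted Hölder space $C^{s,a}_{-q}$ and $k$ in $C^{s-1,a}_{-q}$, and $\mu r,|J|_g r\in L^1$ on the ends, where $r$ is the area radius, $\mu=\frac12(R+(\operatorname{tr}_gk)^2-|k|_g^2+n(n-1))$ and $J=\operatorname{div}(k-(\operatorname{tr}_gk)g)$. Fix an end and the ball model $b=\xi^{-2}\delta$, $\xi=\frac{1-|z|^2}2$, of $\mathbb H^n$. For a function $N$ and a vector field $X$ let $$\mathcal H(N,X)=\lim_{R\to\infty}\frac1{2(n-1)\omega_{n-1}}\int_{S_R}\big(\mathbb U^i(N)+\mathbb V^i(X)\big)\nu_i\,dA,$$ $$\mathbb U^i(N)=2\big(Ng^{i[k}g^{j]l}\mathring\nabla_jg_{kl}+\mathring\nabla^{[i}N\,g^{j]k}(g_{jk}-b_{jk})\big),\qquad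 \mathbb V^i(X)=2\big(k^i{}_j-(\operatorname{tr}_gk)\delta^i_j\big)X^j,$$ where $S_R$ is the centred sphere $\{r=R\}$, $\nu$ and $dA$ are its outward unit normal and area element with respect to $b$, $\mathring\nabla$ is the Levi-Civita connection of $b$, and $\omega_{n-1}$ is the area of the unit sphere $S^{n-1}$. Let the energy $\mathcal E$, linear momentum $\mathcal P$, center of mass $\mathcal C$ and angular momentum $\mathcal A$ of the end be defined by the following limits (it being understood that these limits exist): $$\mathcal E=\mathcal H\Big(\tfrac{2(1+|z|^2)}{1-|z|^2},0\Big),\quad \mathcal P_i=\mathcal H\Big(\tfrac{-4z_i}{1-|z|^2},0\Big),\quad \mathcal C_i=\mathcal H\big(0,(1+|z|^2)\partial_i-2z_iz_k\partial_k\big),\quad \mathcal A_{ij}=\mathcal H(0,z_i\partial_j-z_j\partial_i).$$ Let $\mathcal S$ be a spinor module of Euclidean $\mathbb R^n$ (a unitary complex Clifford module of dimension $2^{\lfloor n/2\rfloor}$, $e_i^2=-1$), $\overline{\mathcal S}=\mathcal S\oplus\mathcal S$ with $e_i(\psi_1,\psi_2)=(e_i\psi_1,-e_i\psi_2)$, $e_0(\psi_1,\psi_2)=(\psi_2,\psi_1)$,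 and put $N(\psi)=|\psi|^2$, $X(\psi)=\langle e_ie_0\psi,\psi\rangle e_i$, $Y(\psi)=\langle \mathbf i e_i\psi,\psi\rangle e_i$. A constant spinor $u\in\overline{\mathcal S}$ defines the imaginary Killing spinor $\psi_u=\xi^{-1/2}(1-\mathbf i\,z)u$ on $\mathbb H^n$ ($z$ acting by Clifford multiplication, the spinor bundle being trivialized by the $b$-orthonormal frame $\xi\partial_i$). It is called null if $|X(\psi_u)|=N(\psi_u)$ everywhere, type I if $|Y(\psi_u)|=N(\psi_u)$ everywhere, and mass-minimizing if it minimizes $\mathcal H(N(\psi_u),X(\psi_u))$ among all $\psi_v$ with $|v|=|u|$. Theorem. In each of the following cases there exists $u\neq0$ such that $\psi_u$ is a type I null mass-minimizing imaginary Killing spinor: 1. $\mathcal A=0$; 2. $\mathcal A$ is simple, i.e. $\mathcal A=a\,e\wedge f$ with $a\in\mathbb R$ and $e,f$ orthonormal, and $\mathcal C=0$; 3. $\mathcal A$ is simple and $\mathcal P=0$. -/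

import Mathlib

open scoped Manifold ContDiff Topology Bundle

noncomputable section

namespace AdS

/-- Euclidean space, the model space of an `n`-manifold. Its open unit ball is also the underlying
set of the ball model of hyperbolic space. -/
abbrev E (n : ℕ) := EuclideanSpace ℝ (Fin n)

/-- The `i`-th standard basis vector. -/
def stdVec {n : ℕ} (i : Fin n) : E n := EuclideanSpace.single i 1

/-- The `i`-th partial derivative of a real function. -/
def partialD {n : ℕ} (i : Fin n) (f : E n → ℝ) (z : E n) : ℝ := fderiv ℝ f z (stdVec i)

/-! ### Hyperbolic space in the ball model -/

/-- The conformal factor `ξ = (1 - |z|²) / 2` of the ball model. -/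
def xi {n : ℕ} (z : E n) : ℝ := (1 - ‖z‖ ^ 2) / 2

/-- Components of the hyperbolic metric `b = ξ⁻² δ` in the ball coordinates. -/
def hypMetric {n : ℕ} (z : E n) : Matrix (Fin n) (Fin n) ℝ := (xi z ^ 2)⁻¹ • 1

/-- The area radius `r = 2|z| / (1 - |z|²)` at a point of the ball. -/
def areaRadius {n : ℕ} (z : E n) : ℝ := 2 * ‖z‖ / (1 - ‖z‖ ^ 2)

/-- The Euclidean radius of the coordinate sphere of area radius `R` (inverse of `areaRadius`). -/
def ballRadius (R : ℝ) : ℝ := R / (1 + √(1 + R ^ 2))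

/-- The complement in hyperbolic space of the closed centred ball of area radius `R₀`. -/
def exterior (n : ℕ) (R₀ : ℝ) : Set (E n) := {z | ‖z‖ < 1 ∧ R₀ < areaRadius z}

/-- The hyperbolic distance of two points of the ball. -/
def hypDist {n : ℕ} (z w : E n) : ℝ :=
  2 * Real.arsinh (‖z - w‖ / √((1 - ‖z‖ ^ 2) * (1 - ‖w‖ ^ 2)))

/-- Derivative of a function along the `b`-orthonormal frame vector `ξ ∂_i`. -/
def frameD {n : ℕ} (i : Fin n) (f : E n → ℝ) (z : E n) : ℝ := xi z * partialD i f z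

/-- Iterated derivative along vectors of the `b`-orthonormal frame `ξ ∂_1, …, ξ ∂_n`. -/
def iterFrameD {n : ℕ} (I : List (Fin n)) (f : E n → ℝ) : E n → ℝ := I.foldr frameD f

/-- The weighted Hölder space `C^{s,a}_{-q}` on the exterior region: the functions that are `C^s`
there, whose derivatives up to order `s` in the `b`-orthonormal frame are `O(r^{-q})`, and whose
derivatives of order `s` have `a`-Hölder seminorm `O(r^{-q})` on hyperbolic unit balls. (The
connection coefficients of the frame `ξ ∂_i` and all their frame derivatives are bounded, so that
bounding the frame derivatives of the components of a tensor up to order `s` is the same as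
bounding its covariant derivatives up to order `s`.) -/
def InWeightedHolder {n : ℕ} (R₀ : ℝ) (s : ℕ) (a q : ℝ) (f : E n → ℝ) : Prop :=
  ContDiffOn ℝ s f (exterior n R₀) ∧
  (∃ C : ℝ, ∀ I : List (Fin n), I.length ≤ s → ∀ z ∈ exterior n R₀,
    areaRadius z ^ q * |iterFrameD I f z| ≤ C) ∧
  (∃ C : ℝ, ∀ I : List (Fin n), I.length = s → ∀ z ∈ exterior n R₀,
    ∀ x ∈ exterior n R₀, ∀ y ∈ exterior n R₀, hypDist z x < 1 → hypDist z y < 1 →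
      areaRadius z ^ q * |iterFrameD I f x - iterFrameD I f y| ≤ C * hypDist x y ^ a)

/-! ### Tensor calculus in coordinates

A field of bilinear forms on a coordinate domain is given by its matrix of components. -/

/-- Christoffel symbols `Γ^m_{ij}` of the metric `G`. -/
def christoffel {n : ℕ} (G : E n → Matrix (Fin n) (Fin n) ℝ) (z : E n) (m i j : Fin n) : ℝ :=
  (1 / 2) * ∑ l, (G z)⁻¹ m l *
    (partialD i (fun w => G w j l) z + partialD j (fun w => G w i l) z
      - partialD l (fun w => G w i j) z)

/-- The covariant derivative `∇_m T_{ij}` for the Levi-Civita connection of the metric `G`. -/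
def covD {n : ℕ} (G T : E n → Matrix (Fin n) (Fin n) ℝ) (z : E n) (m i j : Fin n) : ℝ :=
  partialD m (fun w => T w i j) z
    - ∑ l, (christoffel G z l m i * T z l j + christoffel G z l m j * T z i l)

/-- The Ricci tensor of the metric `G`. -/
def ricci {n : ℕ} (G : E n → Matrix (Fin n) (Fin n) ℝ) (z : E n) (i j : Fin n) : ℝ :=
  ∑ m, (partialD m (fun w => christoffel G w m i j) z
      - partialD i (fun w => christoffel G w m m j) z
      + ∑ l, (christoffel G z m m l * christoffel G z l i j
        - christoffel G z m i l * christoffel G z l m j))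

/-- The scalar curvature of the metric `G`. -/
def scalarCurv {n : ℕ} (G : E n → Matrix (Fin n) (Fin n) ℝ) (z : E n) : ℝ :=
  ∑ i, ∑ j, (G z)⁻¹ i j * ricci G z i j

/-- The trace of `K` with respect to the metric `G`. -/
def traceK {n : ℕ} (G K : E n → Matrix (Fin n) (Fin n) ℝ) (z : E n) : ℝ :=
  ∑ i, ∑ j, (G z)⁻¹ i j * K z i j

/-- The squared norm of `K` with respect to the metric `G`. -/
def normSqK {n : ℕ} (G K : E n → Matrix (Fin n) (Fin n) ℝ) (z : E n) : ℝ :=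
  ∑ i, ∑ j, ∑ l, ∑ m, (G z)⁻¹ i l * (G z)⁻¹ j m * K z i j * K z l m

/-- The energy density `μ = (R + (tr k)² - |k|² + n(n-1)) / 2`. -/
def energyDensity {n : ℕ} (G K : E n → Matrix (Fin n) (Fin n) ℝ) (z : E n) : ℝ :=
  (1 / 2) * (scalarCurv G z + traceK G K z ^ 2 - normSqK G K z + (n : ℝ) * ((n : ℝ) - 1))

/-- The momentum density `J = div (k - (tr k) g)`. -/
def momentumDensity {n : ℕ} (G K : E n → Matrix (Fin n) (Fin n) ℝ) (z : E n) (i : Fin n) : ℝ :=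
  ∑ j, ∑ l, (G z)⁻¹ j l * covD G (fun w => K w - traceK G K w • G w) z l j i

/-- The norm `|J|_g`. -/
def momentumNorm {n : ℕ} (G K : E n → Matrix (Fin n) (Fin n) ℝ) (z : E n) : ℝ :=
  √(∑ i, ∑ j, (G z)⁻¹ i j * momentumDensity G K z i * momentumDensity G K z j)

/-! ### Asymptotically AdS initial data sets -/

/-- A `C^{s,a}_{-q}`-asymptotically AdS initial data set structure on the complete connected
Riemannian manifold `M` without boundary (whose metric is `g`).

The integrability of `μ r̄` and `|J| r̄` is required on each end. On the compact rest of `M` it is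
automatic, since `g` is `C²` and `k` is `C¹`. -/
structure AsymptoticallyAdS (n s : ℕ) (a q : ℝ) (M : Type*) [MetricSpace M]
    [ChartedSpace (E n) M] [IsManifold 𝓘(ℝ, E n) ∞ M]
    [Bundle.RiemannianBundle (fun x : M => TangentSpace 𝓘(ℝ, E n) x)]
    [IsContMDiffRiemannianBundle 𝓘(ℝ, E n) 2 (E n) (fun x : M => TangentSpace 𝓘(ℝ, E n) x)]
    [IsRiemannianManifold 𝓘(ℝ, E n) M] [CompleteSpace M] [ConnectedSpace M] where
  /-- The symmetric two-tensor `k`. -/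
  k : ∀ x : M, TangentSpace 𝓘(ℝ, E n) x →L[ℝ] TangentSpace 𝓘(ℝ, E n) x →L[ℝ] ℝ
  k_symm : ∀ x v w, k x v w = k x w v
  k_contMDiff : ContMDiff 𝓘(ℝ, E n) (𝓘(ℝ, E n).prod 𝓘(ℝ, E n →L[ℝ] E n →L[ℝ] ℝ)) 1
    (fun x : M => Bundle.TotalSpace.mk' (E n →L[ℝ] E n →L[ℝ] ℝ)
      (E := fun x : M => TangentSpace 𝓘(ℝ, E n) x →L[ℝ] TangentSpace 𝓘(ℝ, E n) x →L[ℝ] ℝ)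
      x (k x))
  /-- The compact core. -/
  core : Set M
  isCompact_core : IsCompact core
  numEnds : ℕ
  /-- The charts `φ^ℓ` of the ends, diffeomorphisms onto complements of balls in `ℍⁿ`. -/
  chart : Fin numEnds → OpenPartialHomeomorph M (E n)
  R₀ : Fin numEnds → ℝ
  R₀_pos : ∀ l, 0 < R₀ l
  chart_target : ∀ l, (chart l).target = exterior n (R₀ l)
  chart_smooth : ∀ l, ContMDiffOn 𝓘(ℝ, E n) 𝓘(ℝ, E n) ∞ (chart l) (chart l).source
  chart_symm_smooth :
    ∀ l, ContMDiffOn 𝓘(ℝ, E n) 𝓘(ℝ, E n) ∞ (chart l).symm (chart l).target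
  ends_disjoint : ∀ l m, l ≠ m → Disjoint (chart l).source (chart m).source
  ends_cover : ⋃ l, (chart l).source = coreᶜ
  /-- The components of `g` on the ends, in the ball coordinates. -/
  gEnd : Fin numEnds → E n → Matrix (Fin n) (Fin n) ℝ
  gEnd_eq : ∀ l, ∀ z ∈ exterior n (R₀ l), ∀ i j, gEnd l z i j =
    inner ℝ (mfderiv 𝓘(ℝ, E n) 𝓘(ℝ, E n) (chart l).symm z (stdVec i))
      (mfderiv 𝓘(ℝ, E n) 𝓘(ℝ, E n) (chart l).symm z (stdVec j))
  /-- The components of `k` on the ends, in the ball coordinates. -/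
  kEnd : Fin numEnds → E n → Matrix (Fin n) (Fin n) ℝ
  kEnd_eq : ∀ l, ∀ z ∈ exterior n (R₀ l), ∀ i j, kEnd l z i j =
    k ((chart l).symm z) (mfderiv 𝓘(ℝ, E n) 𝓘(ℝ, E n) (chart l).symm z (stdVec i))
      (mfderiv 𝓘(ℝ, E n) 𝓘(ℝ, E n) (chart l).symm z (stdVec j))
  /-- Decay of the components of `g - b` in the `b`-orthonormal frame `ξ ∂_i`. -/
  metric_decay : ∀ l i j,
    InWeightedHolder (R₀ l) s a q (fun z => xi z ^ 2 * (gEnd l z i j - hypMetric z i j))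
  /-- Decay of the components of `k` in the `b`-orthonormal frame `ξ ∂_i`. -/
  k_decay : ∀ l i j,
    InWeightedHolder (R₀ l) (s - 1) a q (fun z => xi z ^ 2 * kEnd l z i j)
  energy_integrable : ∀ l, MeasureTheory.IntegrableOn
    (fun z => energyDensity (gEnd l) (kEnd l) z * areaRadius z * √(gEnd l z).det)
    (exterior n (R₀ l))
  momentum_integrable : ∀ l, MeasureTheory.IntegrableOn
    (fun z => momentumNorm (gEnd l) (kEnd l) z * areaRadius z * √(gEnd l z).det)
    (exterior n (R₀ l))

/-! ### The mass functional -/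

/-- `𝕌^i(N) = 2 (N g^{i[k} g^{j]l} ∇̊_j g_{kl} + ∇̊^{[i} N g^{j]k} (g_{jk} - b_{jk}))`, where the
brackets denote antisymmetrization with the factor `1/2`, so that
`2 g^{i[k} g^{j]l} = g^{ik} g^{jl} - g^{ij} g^{kl}`, and `∇̊^i N = ξ² ∂_i N` is the `b`-gradient. -/
def fluxU {n : ℕ} (G : E n → Matrix (Fin n) (Fin n) ℝ) (N : E n → ℝ) (z : E n) (i : Fin n) : ℝ :=
  N z * (∑ j, ∑ k, ∑ l, ((G z)⁻¹ i k * (G z)⁻¹ j l - (G z)⁻¹ i j * (G z)⁻¹ k l)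
      * covD hypMetric G z j k l)
    + ∑ j, ∑ k, (xi z ^ 2 * partialD i N z * (G z)⁻¹ j k
      - xi z ^ 2 * partialD j N z * (G z)⁻¹ i k) * (G z j k - hypMetric z j k)

/-- `𝕍^i(X) = 2 (k^i_j - (tr_g k) δ^i_j) X^j`, for a vector field `X` with components `X^j` in the
ball coordinates. -/
def fluxV {n : ℕ} (G K : E n → Matrix (Fin n) (Fin n) ℝ) (X : E n → Fin n → ℝ) (z : E n)
    (i : Fin n) : ℝ :=
  2 * ∑ j, ((∑ l, (G z)⁻¹ i l * K z l j) - traceK G K z * (if i = j then 1 else 0)) * X z j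

/-- The flux `(2 (n-1) ω_{n-1})⁻¹ ∫_{S_R} (𝕌^i(N) + 𝕍^i(X)) ν_i dA` through the sphere of area
radius `R`, written as an integral over the unit sphere: at `z = ϱ σ` with `|σ| = 1` the conormal
of the sphere is `ν_i = ξ⁻¹ σ_i` and its area element is `dA = ξ^{-(n-1)} ϱ^{n-1} dσ`. -/
def flux {n : ℕ} (G K : E n → Matrix (Fin n) (Fin n) ℝ) (N : E n → ℝ) (X : E n → Fin n → ℝ)
    (R : ℝ) : ℝ :=
  (2 * ((n : ℝ) - 1) *
      ((MeasureTheory.volume : MeasureTheory.Measure (E n)).toSphere Set.univ).toReal)⁻¹ *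
    ∫ σ : Metric.sphere (0 : E n) 1,
      (∑ i, (fluxU G N (ballRadius R • (σ : E n)) i + fluxV G K X (ballRadius R • (σ : E n)) i)
          * ((xi (ballRadius R • (σ : E n)))⁻¹ * (σ : E n) i))
        * ((xi (ballRadius R • (σ : E n)))⁻¹ ^ (n - 1) * ballRadius R ^ (n - 1))
      ∂((MeasureTheory.volume : MeasureTheory.Measure (E n)).toSphere)

/-- `HasMass G K N X m` means `ℋ(N, X) = m`: the fluxes through `S_R` converge to `m` as
`R → ∞`. -/
def HasMass {n : ℕ} (G K : E n → Matrix (Fin n) (Fin n) ℝ) (N : E n → ℝ) (X : E n → Fin n → ℝ)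
    (m : ℝ) : Prop :=
  Filter.Tendsto (flux G K N X) Filter.atTop (𝓝 m)

/-- The end with metric `G` and second fundamental form `K` has the energy `𝓔`, the linear
momentum `𝓟`, the center of mass `𝓒` and the angular momentum `𝓐`:
`𝓔 = ℋ(2(1+|z|²)/(1-|z|²), 0)`, `𝓟_i = ℋ(-4z_i/(1-|z|²), 0)`,
`𝓒_i = ℋ(0, (1+|z|²) ∂_i - 2 z_i z_k ∂_k)` and `𝓐_ij = ℋ(0, z_i ∂_j - z_j ∂_i)`. -/
structure HasCharges {n : ℕ} (G K : E n → Matrix (Fin n) (Fin n) ℝ) (energy : ℝ)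
    (linMom center : E n) (angMom : Matrix (Fin n) (Fin n) ℝ) : Prop where
  hasEnergy : HasMass G K (fun z => 2 / (1 - ‖z‖ ^ 2) * (1 + ‖z‖ ^ 2)) (fun _ _ => 0) energy
  hasLinMom : ∀ i, HasMass G K (fun z => -2 * (2 / (1 - ‖z‖ ^ 2) * z i)) (fun _ _ => 0) (linMom i)
  hasCenter : ∀ i, HasMass G K (fun _ => 0)
    (fun z k => (1 + ‖z‖ ^ 2) * (if k = i then 1 else 0) - 2 * z i * z k) (center i)
  hasAngMom : ∀ i j, HasMass G K (fun _ => 0)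
    (fun z k => z i * (if k = j then 1 else 0) - z j * (if k = i then 1 else 0)) (angMom i j)

/-- A two-form is simple if it is `a e ∧ f` for a real number `a` and orthonormal `e`, `f`. -/
def IsSimple {n : ℕ} (A : Matrix (Fin n) (Fin n) ℝ) : Prop :=
  ∃ (a : ℝ) (e f : E n), ‖e‖ = 1 ∧ ‖f‖ = 1 ∧ inner ℝ e f = (0 : ℝ) ∧
    ∀ i j, A i j = a * (e i * f j - e j * f i)

/-! ### Spinors -/

/-- `S` is a complex spinor module of Euclidean `n`-space: a unitary module over the Clifford
algebra (with `e_i² = -1`) of the dimension `2^⌊n/2⌋` of the irreducible ones. -/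
structure SpinorModule (n : ℕ) (S : Type*) [NormedAddCommGroup S] [InnerProductSpace ℂ S] where
  /-- Clifford multiplication. -/
  cliff : E n →ₗ[ℝ] (S →ₗ[ℂ] S)
  cliff_sq : ∀ v ψ, cliff v (cliff v ψ) = -(((‖v‖ ^ 2 : ℝ) : ℂ) • ψ)
  cliff_skew : ∀ v ψ χ, inner ℂ (cliff v ψ) χ = -inner ℂ ψ (cliff v χ)
  finrank_eq : Module.finrank ℂ S = 2 ^ (n / 2)

/-- The spacetime spinors `S ⊕ S`. -/
abbrev DoubleSpinor (S : Type*) := WithLp 2 (S × S)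

section Spinors

variable {n : ℕ} {S : Type*} [NormedAddCommGroup S] [InnerProductSpace ℂ S]

/-- Clifford multiplication by a spatial vector: `v (ψ₁, ψ₂) = (v ψ₁, -v ψ₂)`. -/
def spaceMul (c : SpinorModule n S) (v : E n) (ψ : DoubleSpinor S) : DoubleSpinor S :=
  WithLp.toLp 2 (c.cliff v ψ.fst, -c.cliff v ψ.snd)

/-- Clifford multiplication by the timelike unit vector: `e₀ (ψ₁, ψ₂) = (ψ₂, ψ₁)`. -/
def timeMul (ψ : DoubleSpinor S) : DoubleSpinor S := WithLp.toLp 2 (ψ.snd, ψ.fst)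

/-- `N(ψ) = |ψ|²`. -/
def currentN (ψ : DoubleSpinor S) : ℝ := ‖ψ‖ ^ 2

/-- `X(ψ) = ⟨e_i e_0 ψ, ψ⟩ e_i`. -/
def currentX (c : SpinorModule n S) (ψ : DoubleSpinor S) : E n :=
  WithLp.toLp 2 fun i => (inner ℂ ψ (spaceMul c (stdVec i) (timeMul ψ))).re

/-- `Y(ψ) = ⟨𝐢 e_i ψ, ψ⟩ e_i`. -/
def currentY (c : SpinorModule n S) (ψ : DoubleSpinor S) : E n :=
  WithLp.toLp 2 fun i => (inner ℂ ψ (Complex.I • spaceMul c (stdVec i) ψ)).re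

/-- A spinor is null if `|X| = N`. -/
def IsNull (c : SpinorModule n S) (ψ : DoubleSpinor S) : Prop := ‖currentX c ψ‖ = currentN ψ

/-- A spinor is of type I if `N = |Y|`. -/
def IsTypeI (c : SpinorModule n S) (ψ : DoubleSpinor S) : Prop := currentN ψ = ‖currentY c ψ‖

/-- The imaginary Killing spinor `ψ^∞ = ξ^{-1/2} (1 - 𝐢 ϱ e_ϱ) u` on `ℍⁿ` corresponding to the
constant spinor `u` (`ϱ e_ϱ` being the position vector `z`), in the trivialization of the spinor
bundle by the `b`-orthonormal frame `ξ ∂_i`. -/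
def killingSpinor (c : SpinorModule n S) (u : DoubleSpinor S) (z : E n) : DoubleSpinor S :=
  ((xi z ^ (-(1 / 2) : ℝ) : ℝ) : ℂ) • (u - Complex.I • spaceMul c z u)

/-- The imaginary Killing equation `∇̊_v ψ = -(𝐢/2) v ψ` on the ball model, for the tangent
vectors `Σ v_i ξ ∂_i`. By the conformal transformation formula, the spin
connection of `b = ξ⁻² δ` is
`∇̊_{ξ v} ψ = ξ (∂_v ψ + (1/2) v (grad log ξ) ψ + (1/2) (∂_v log ξ) ψ)`, where
`grad log ξ = -ξ⁻¹ z`. -/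
def IsImaginaryKilling (c : SpinorModule n S) (ψ : E n → DoubleSpinor S) : Prop :=
  ∀ z : E n, ‖z‖ < 1 → ∀ v : E n, ∃ ψ' : DoubleSpinor S,
    HasDerivAt (fun t : ℝ => ψ (z + t • v)) ψ' 0 ∧
    ((xi z : ℝ) : ℂ) • ψ' - (1 / 2 : ℂ) • spaceMul c v (spaceMul c z (ψ z))
      - ((1 / 2 * inner ℝ v z : ℝ) : ℂ) • ψ z = -(Complex.I / 2) • spaceMul c v (ψ z)

theorem spaceMul_add_smul (c : SpinorModule n S) (z v : E n) (t : ℝ) (ψ : DoubleSpinor S) :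
    spaceMul c (z + t • v) ψ = spaceMul c z ψ + ((t : ℝ) : ℂ) • spaceMul c v ψ := by
  refine WithLp.ofLp_injective 2 (Prod.ext ?_ ?_)
  · simp [spaceMul]
  · simp [spaceMul]
    abel

theorem spaceMul_sub_smul (c : SpinorModule n S) (v : E n) (a : ℂ) (ψ χ : DoubleSpinor S) :
    spaceMul c v (ψ - a • χ) = spaceMul c v ψ - a • spaceMul c v χ := by
  refine WithLp.ofLp_injective 2 (Prod.ext ?_ ?_)
  · simp [spaceMul]
  · simp [spaceMul]
    abel

theorem spaceMul_smul (c : SpinorModule n S) (v : E n) (a : ℂ) (ψ : DoubleSpinor S) :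
    spaceMul c v (a • ψ) = a • spaceMul c v ψ := by
  refine WithLp.ofLp_injective 2 (Prod.ext ?_ ?_) <;> simp [spaceMul]

theorem spaceMul_sq (c : SpinorModule n S) (v : E n) (ψ : DoubleSpinor S) :
    spaceMul c v (spaceMul c v ψ) = -(((‖v‖ ^ 2 : ℝ) : ℂ) • ψ) := by
  refine WithLp.ofLp_injective 2 (Prod.ext ?_ ?_) <;> simp [spaceMul, c.cliff_sq]

/-- The spinors `ψ^∞` are imaginary Killing spinors. -/
theorem isImaginaryKilling_killingSpinor (c : SpinorModule n S) (u : DoubleSpinor S) :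
    IsImaginaryKilling c (killingSpinor c u) := by
  intro z hz v
  have hxi : 0 < xi z := by
    have : ‖z‖ ^ 2 < 1 := by nlinarith [norm_nonneg z]
    unfold xi; linarith
  have h1 : HasDerivAt (fun t : ℝ => xi (z + t • v)) (-inner ℝ v z) 0 := by
    have : (fun t : ℝ => xi (z + t • v)) =
        fun t : ℝ => (1 - (‖z‖ ^ 2 + 2 * (t * inner ℝ v z) + t ^ 2 * ‖v‖ ^ 2)) / 2 := by
      funext t
      rw [xi, norm_add_sq_real, norm_smul, mul_pow, real_inner_smul_right, real_inner_comm,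
        Real.norm_eq_abs, sq_abs]
    rw [this]
    have e1 := ((hasDerivAt_id (0 : ℝ)).mul_const (inner ℝ v z)).const_mul 2
    have e2 := ((hasDerivAt_id (0 : ℝ)).pow 2).mul_const (‖v‖ ^ 2)
    have e3 := ((((e1.const_add (‖z‖ ^ 2)).add e2).const_sub 1).div_const 2)
    refine e3.congr_deriv ?_
    simp
    ring
  have h2 : HasDerivAt (fun t : ℝ => xi (z + t • v) ^ (-(1 / 2) : ℝ))
      (1 / 2 * inner ℝ v z * (xi z)⁻¹ * xi z ^ (-(1 / 2) : ℝ)) 0 := by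
    refine (h1.rpow_const (p := -(1 / 2)) (Or.inl (by simpa using hxi.ne'))).congr_deriv ?_
    simp only [zero_smul, add_zero]
    rw [Real.rpow_sub_one hxi.ne']
    ring
  have h3 : HasDerivAt (fun t : ℝ => u - Complex.I • spaceMul c (z + t • v) u)
      (-(Complex.I • spaceMul c v u)) 0 := by
    have : (fun t : ℝ => u - Complex.I • spaceMul c (z + t • v) u) =
        fun t : ℝ => (u - Complex.I • spaceMul c z u) - ((t : ℝ) : ℂ) •
          (Complex.I • spaceMul c v u) := by
      funext t
      rw [spaceMul_add_smul, smul_add, smul_comm ((t : ℝ) : ℂ)]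
      abel
    rw [this]
    have e1 : HasDerivAt (fun t : ℝ => ((t : ℝ) : ℂ)) 1 0 := Complex.ofRealCLM.hasDerivAt
    have e2 := (e1.smul_const (Complex.I • spaceMul c v u)).const_sub
      (u - Complex.I • spaceMul c z u)
    simpa using e2
  refine ⟨_, (h2.ofReal_comp.smul h3), ?_⟩
  have hz2 : ((‖z‖ ^ 2 : ℝ) : ℂ) = 1 - 2 * ((xi z : ℝ) : ℂ) := by
    have : ‖z‖ ^ 2 = 1 - 2 * xi z := by unfold xi; ring
    rw [this]; push_cast; ring
  have hne : ((xi z : ℝ) : ℂ) ≠ 0 := by exact_mod_cast hxi.ne'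
  simp only [killingSpinor, zero_smul, add_zero, spaceMul_smul, spaceMul_sub_smul, spaceMul_sq, hz2]
  generalize xi z ^ (-(1 / 2) : ℝ) = f
  generalize spaceMul c v (spaceMul c z u) = p
  have hneg : spaceMul c v (-((1 - 2 * ((xi z : ℝ) : ℂ)) • u)) =
      -((1 - 2 * ((xi z : ℝ) : ℂ)) • spaceMul c v u) := by
    rw [← neg_smul, spaceMul_smul, neg_smul]
  rw [hneg]
  generalize spaceMul c v u = w
  generalize spaceMul c z u = y
  push_cast
  match_scalars <;> field_simp <;> ring_nf <;> simp

/-- `ℋ(N(ψ^∞), X(ψ^∞)) = m` for the imaginary Killing spinor `ψ^∞` corresponding to `u`. The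
components of `X(ψ^∞)` in the frame `ξ ∂_i` are multiplied by `ξ` to get those in the ball
coordinates. -/
def HasSpinorMass (c : SpinorModule n S) (G K : E n → Matrix (Fin n) (Fin n) ℝ)
    (u : DoubleSpinor S) (m : ℝ) : Prop :=
  HasMass G K (fun z => currentN (killingSpinor c u z))
    (fun z i => xi z * currentX c (killingSpinor c u z) i) m

/-- The imaginary Killing spinor corresponding to `u` minimizes `ℋ` among all those that correspond
to a constant spinor `v` with `|v| = |u|`. (In particular `ℋ` is defined for all of them.) -/
def IsMassMinimizing (c : SpinorModule n S) (G K : E n → Matrix (Fin n) (Fin n) ℝ)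
    (u : DoubleSpinor S) : Prop :=
  ∃ m, HasSpinorMass c G K u m ∧
    ∀ v : DoubleSpinor S, ‖v‖ = ‖u‖ → ∃ m', HasSpinorMass c G K v m' ∧ m ≤ m'

end Spinors

end AdS

end

/-! The mass `ℋ(N(ψ_u), X(ψ_u))` is a quadratic form in the constant spinor `u`. Expanding `(1 - 𝐢
z) T (1 - 𝐢 z)` for `T = 1` and `T = e_j e₀` writes `N(ψ_u)` and the ball components of `X(ψ_u)` as
combinations of the lapses and shifts that define the charges, with expectation values in `u` as
coefficients. As the flux is linear in lapse and shift, the mass is the expectation of `massOp`,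
that is `𝓔 + 𝐢 𝓟 + 𝓒 e₀ + Σ 𝓐_ij rotGen_ij` (`HasCharges.hasSpinorMass`). Minimizing it over a
sphere means finding a lowest eigenvector.

For orthonormal `x`, `y` the symmetric involutions `x e₀` and `𝐢 y` commute and have a common fixed
spinor `u ≠ 0` (`exists_fixed_spinor`). Then `ψ_u` is a multiple of `(y - z) u`, and Clifford
multiplication by `y - z` turns the two relations for `u` into relations of the same kind for
`ψ_u(z)`, with `x` and `y` reflected. Hence `ψ_u` is null and of type I at every point
(`killingSpinor_null_typeI`).

It remains to choose `x`, `y` such that these `u` minimize. In each case the operator without its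
energy term equals `-(r T₁ + s T₂)` with `r, s ≥ 0` and symmetric involutions `T₁`, `T₂` that fix
every such `u`, so the lower bound `-(r + s)` is attained (`minimizedByFixed_of_involutions`). If `𝓐
= 0`, the splitting comes from a singular value decomposition of the pair `(𝓟, 𝓒)`. If `𝓐` is simple
and one of the two vectors vanishes, the other is split along the plane of `𝓐`: the tangential term
commutes with the rotation term, and the normal term anticommutes with both. -/

namespace AdS
-- Clifford algebra on spacetime spinors and expectation values.
section SpinorAlgebra

variable {n : ℕ} {S : Type*} [NormedAddCommGroup S] [InnerProductSpace ℂ S]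

theorem spaceMul_add (c : SpinorModule n S) (v : E n) (ψ χ : DoubleSpinor S) :
    spaceMul c v (ψ + χ) = spaceMul c v ψ + spaceMul c v χ := by
  refine WithLp.ofLp_injective 2 (Prod.ext ?_ ?_)
  · simp [spaceMul]
  · simp [spaceMul]
    abel

/-- Clifford multiplication by a spatial vector as an endomorphism of the spacetime spinors. -/
noncomputable def spaceOp (c : SpinorModule n S) (v : E n) : Module.End ℂ (DoubleSpinor S) where
  toFun := spaceMul c v
  map_add' := spaceMul_add c v
  map_smul' := spaceMul_smul c v

/-- Clifford multiplication by the timelike unit vector as an endomorphism. -/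
noncomputable def timeOp (S : Type*) [NormedAddCommGroup S] [InnerProductSpace ℂ S] :
    Module.End ℂ (DoubleSpinor S) where
  toFun := timeMul
  map_add' _ _ := rfl
  map_smul' _ _ := rfl

@[simp] theorem spaceOp_apply (c : SpinorModule n S) (v : E n) (ψ : DoubleSpinor S) :
    spaceOp c v ψ = spaceMul c v ψ := rfl

@[simp] theorem timeOp_apply (ψ : DoubleSpinor S) : timeOp S ψ = timeMul ψ := rfl

theorem spaceOp_add (c : SpinorModule n S) (v w : E n) :
    spaceOp c (v + w) = spaceOp c v + spaceOp c w := by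
  refine LinearMap.ext fun ψ => WithLp.ofLp_injective 2 (Prod.ext ?_ ?_)
  · simp [spaceMul]
  · simp [spaceMul]
    abel

theorem spaceOp_smul (c : SpinorModule n S) (r : ℝ) (v : E n) :
    spaceOp c (r • v) = (r : ℂ) • spaceOp c v := by
  refine LinearMap.ext fun ψ => WithLp.ofLp_injective 2 (Prod.ext ?_ ?_) <;> simp [spaceMul]

theorem spaceOp_neg (c : SpinorModule n S) (v : E n) : spaceOp c (-v) = -spaceOp c v := by
  simpa using spaceOp_smul c (-1) v

theorem spaceOp_sub (c : SpinorModule n S) (v w : E n) :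
    spaceOp c (v - w) = spaceOp c v - spaceOp c w := by
  rw [sub_eq_add_neg, spaceOp_add, spaceOp_neg, sub_eq_add_neg]

theorem spaceOp_zero (c : SpinorModule n S) : spaceOp c (0 : E n) = 0 := by
  simpa using spaceOp_smul c 0 (0 : E n)

theorem spaceOp_sum (c : SpinorModule n S) {ι : Type*} (s : Finset ι) (f : ι → E n) :
    spaceOp c (∑ i ∈ s, f i) = ∑ i ∈ s, spaceOp c (f i) := by
  classical
  induction s using Finset.induction_on with
  | empty => simpa using spaceOp_zero c
  | insert i s hi ih => rw [Finset.sum_insert hi, Finset.sum_insert hi, spaceOp_add, ih]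

theorem sum_smul_stdVec (v : E n) : ∑ i, v i • stdVec i = v := by
  ext j
  simp [stdVec, Pi.single_apply]

theorem spaceOp_eq_sum (c : SpinorModule n S) (v : E n) :
    spaceOp c v = ∑ i, (v i : ℂ) • spaceOp c (stdVec i) := by
  conv_lhs => rw [← sum_smul_stdVec v]
  rw [spaceOp_sum]
  exact Finset.sum_congr rfl fun i _ => spaceOp_smul c _ _

theorem spaceOp_mul_self (c : SpinorModule n S) (v : E n) :
    spaceOp c v * spaceOp c v = -(((‖v‖ ^ 2 : ℝ) : ℂ) • 1) :=
  LinearMap.ext fun ψ => spaceMul_sq c v ψ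

theorem spaceOp_anticomm (c : SpinorModule n S) (v w : E n) :
    spaceOp c v * spaceOp c w + spaceOp c w * spaceOp c v
      = -(((2 * inner ℝ v w : ℝ) : ℂ) • 1) := by
  have h := spaceOp_mul_self c (v + w)
  rw [spaceOp_add, mul_add, add_mul, add_mul, spaceOp_mul_self, spaceOp_mul_self,
    norm_add_sq_real] at h
  push_cast at h ⊢
  rw [add_smul, add_smul] at h
  linear_combination (norm := module) h

theorem timeOp_mul_self : timeOp S * timeOp S = 1 := rfl

theorem timeOp_mul_spaceOp (c : SpinorModule n S) (v : E n) :
    timeOp S * spaceOp c v = -(spaceOp c v * timeOp S) := by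
  refine LinearMap.ext fun ψ => WithLp.ofLp_injective 2 (Prod.ext ?_ ?_) <;>
    simp [spaceMul, timeMul]

theorem inner_spaceMul_left (c : SpinorModule n S) (v : E n) (ψ χ : DoubleSpinor S) :
    inner ℂ (spaceMul c v ψ) χ = -inner ℂ ψ (spaceMul c v χ) := by
  simp [spaceMul, WithLp.prod_inner_apply, c.cliff_skew]
  ring

theorem inner_timeMul_left (ψ χ : DoubleSpinor S) :
    inner ℂ (timeMul ψ) χ = inner ℂ ψ (timeMul χ) := by
  simp [timeMul, WithLp.prod_inner_apply, add_comm]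

/-- The expectation value of an endomorphism in a state. -/
noncomputable def expect (T : Module.End ℂ (DoubleSpinor S)) (ψ : DoubleSpinor S) : ℝ :=
  (inner ℂ ψ (T ψ)).re

theorem expect_add (T U : Module.End ℂ (DoubleSpinor S)) (ψ : DoubleSpinor S) :
    expect (T + U) ψ = expect T ψ + expect U ψ := by
  simp only [expect, LinearMap.add_apply, inner_add_right, Complex.add_re]

theorem expect_neg (T : Module.End ℂ (DoubleSpinor S)) (ψ : DoubleSpinor S) :
    expect (-T) ψ = -expect T ψ := by
  simp [expect]

theorem expect_smul (r : ℝ) (T : Module.End ℂ (DoubleSpinor S)) (ψ : DoubleSpinor S) :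
    expect ((r : ℂ) • T) ψ = r * expect T ψ := by
  simp only [expect, LinearMap.smul_apply, inner_smul_right, Complex.re_ofReal_mul]

theorem expect_one (ψ : DoubleSpinor S) : expect 1 ψ = ‖ψ‖ ^ 2 := by
  have := inner_self_eq_norm_sq (𝕜 := ℂ) ψ
  simpa [expect] using this

theorem expect_sum {ι : Type*} (s : Finset ι) (T : ι → Module.End ℂ (DoubleSpinor S))
    (ψ : DoubleSpinor S) : expect (∑ i ∈ s, T i) ψ = ∑ i ∈ s, expect (T i) ψ := by
  simp only [expect, LinearMap.sum_apply, inner_sum, Complex.re_sum]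

/-- `expect (A T A) ψ` is the expectation of `T` in `A ψ` for symmetric `A`. -/
theorem expect_conj {A : Module.End ℂ (DoubleSpinor S)} (hA : A.IsSymmetric)
    (T : Module.End ℂ (DoubleSpinor S)) (ψ : DoubleSpinor S) :
    expect T (A ψ) = expect (A * T * A) ψ := by
  simp only [expect, Module.End.mul_apply]
  rw [hA]

theorem norm_apply_of_symmetric_involution {T : Module.End ℂ (DoubleSpinor S)}
    (hT : T.IsSymmetric) (h : T * T = 1) (ψ : DoubleSpinor S) : ‖T ψ‖ = ‖ψ‖ := by
  have h1 : ‖T ψ‖ ^ 2 = ‖ψ‖ ^ 2 := by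
    rw [← expect_one, expect_conj hT, mul_one, h, expect_one]
  exact (pow_left_inj₀ (norm_nonneg _) (norm_nonneg _) two_ne_zero).1 h1

theorem expect_le_of_symmetric_involution {T : Module.End ℂ (DoubleSpinor S)}
    (hT : T.IsSymmetric) (h : T * T = 1) (ψ : DoubleSpinor S) : expect T ψ ≤ ‖ψ‖ ^ 2 := by
  calc expect T ψ ≤ ‖inner ℂ ψ (T ψ)‖ := Complex.re_le_norm _
    _ ≤ ‖ψ‖ * ‖T ψ‖ := norm_inner_le_norm _ _
    _ = ‖ψ‖ ^ 2 := by rw [norm_apply_of_symmetric_involution hT h, sq]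

theorem isSymmetric_I_spaceOp (c : SpinorModule n S) (v : E n) :
    (Complex.I • spaceOp c v).IsSymmetric := by
  intro ψ χ
  simp only [LinearMap.smul_apply, spaceOp_apply, inner_smul_left, inner_smul_right,
    inner_spaceMul_left, Complex.conj_I, neg_mul_neg]

theorem isSymmetric_spaceOp_mul_timeOp (c : SpinorModule n S) (v : E n) :
    (spaceOp c v * timeOp S).IsSymmetric := by
  intro ψ χ
  have h := LinearMap.congr_fun (timeOp_mul_spaceOp c v) χ
  simp only [Module.End.mul_apply, LinearMap.neg_apply, spaceOp_apply, timeOp_apply] at h ⊢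
  rw [inner_spaceMul_left, inner_timeMul_left, h, inner_neg_right, neg_neg]

theorem isSymmetric_real_smul {T : Module.End ℂ (DoubleSpinor S)} (hT : T.IsSymmetric) (r : ℝ) :
    ((r : ℂ) • T).IsSymmetric := by
  intro ψ χ
  simp only [LinearMap.smul_apply, inner_smul_left, inner_smul_right, hT ψ χ, Complex.conj_ofReal]

theorem I_spaceOp_mul_self (c : SpinorModule n S) (v : E n) :
    (Complex.I • spaceOp c v) * (Complex.I • spaceOp c v) = ((‖v‖ ^ 2 : ℝ) : ℂ) • 1 := by
  rw [smul_mul_smul_comm, Complex.I_mul_I, spaceOp_mul_self]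
  simp

theorem spaceOp_timeOp_mul_self (c : SpinorModule n S) (v : E n) :
    (spaceOp c v * timeOp S) * (spaceOp c v * timeOp S) = ((‖v‖ ^ 2 : ℝ) : ℂ) • 1 := by
  rw [mul_assoc, ← mul_assoc (timeOp S), timeOp_mul_spaceOp, neg_mul, mul_neg, mul_assoc,
    timeOp_mul_self, mul_one, spaceOp_mul_self, neg_neg]

theorem currentN_eq_expect (ψ : DoubleSpinor S) : currentN ψ = expect 1 ψ := (expect_one ψ).symm

theorem currentX_apply (c : SpinorModule n S) (ψ : DoubleSpinor S) (i : Fin n) :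
    currentX c ψ i = expect (spaceOp c (stdVec i) * timeOp S) ψ := rfl

theorem currentY_apply (c : SpinorModule n S) (ψ : DoubleSpinor S) (i : Fin n) :
    currentY c ψ i = expect (Complex.I • spaceOp c (stdVec i)) ψ := rfl

theorem inner_currentX (c : SpinorModule n S) (ψ : DoubleSpinor S) (v : E n) :
    inner ℝ v (currentX c ψ) = expect (spaceOp c v * timeOp S) ψ := by
  rw [spaceOp_eq_sum, Finset.sum_mul, expect_sum, PiLp.inner_apply]
  refine Finset.sum_congr rfl fun i _ => ?_
  rw [smul_mul_assoc, expect_smul, ← currentX_apply]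
  simp [mul_comm]

theorem inner_currentY (c : SpinorModule n S) (ψ : DoubleSpinor S) (v : E n) :
    inner ℝ v (currentY c ψ) = expect (Complex.I • spaceOp c v) ψ := by
  rw [spaceOp_eq_sum, Finset.smul_sum, expect_sum, PiLp.inner_apply]
  refine Finset.sum_congr rfl fun i _ => ?_
  rw [smul_comm, expect_smul, ← currentY_apply]
  simp [mul_comm]

/-- Used for the currents: their component along a unit vector is the expectation of a symmetric
involution, hence at most `|ψ|²`, and one fixed direction suffices for equality of norms. -/
theorem norm_eq_of_forall_inner_le {w v : E n} {r : ℝ} (hr : 0 ≤ r)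
    (hle : ∀ v : E n, ‖v‖ = 1 → inner ℝ v w ≤ r) (hv : ‖v‖ = 1) (heq : inner ℝ v w = r) :
    ‖w‖ = r := by
  refine le_antisymm ?_ ?_
  · rcases eq_or_ne w 0 with rfl | hw
    · simpa using hr
    · have := hle ((‖w‖)⁻¹ • w) (by simp [norm_smul, hw])
      rwa [real_inner_smul_left, real_inner_self_eq_norm_sq, sq, ← mul_assoc,
        inv_mul_cancel₀ (norm_ne_zero_iff.2 hw), one_mul] at this
  · have := real_inner_le_norm v w
    rwa [hv, one_mul, heq] at this

theorem expect_eq_of_fixed {T : Module.End ℂ (DoubleSpinor S)} {ψ : DoubleSpinor S}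
    (h : T ψ = ψ) : expect T ψ = ‖ψ‖ ^ 2 := by
  rw [← expect_one, expect, h]; rfl

theorem isNull_of_fixed {c : SpinorModule n S} {x : E n} (hx : ‖x‖ = 1) {ψ : DoubleSpinor S}
    (h : spaceMul c x (timeMul ψ) = ψ) : IsNull c ψ := by
  refine norm_eq_of_forall_inner_le (sq_nonneg _) (fun v hv => ?_) hx ?_
  · rw [inner_currentX]
    exact expect_le_of_symmetric_involution (isSymmetric_spaceOp_mul_timeOp c v)
      (by simp [spaceOp_timeOp_mul_self, hv]) ψ
  · rw [inner_currentX, expect_eq_of_fixed h]; rfl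

theorem isTypeI_of_fixed {c : SpinorModule n S} {y : E n} (hy : ‖y‖ = 1) {ψ : DoubleSpinor S}
    (h : Complex.I • spaceMul c y ψ = ψ) : IsTypeI c ψ := by
  refine (norm_eq_of_forall_inner_le (sq_nonneg _) (fun v hv => ?_) hy ?_).symm
  · rw [inner_currentY]
    exact expect_le_of_symmetric_involution (isSymmetric_I_spaceOp c v)
      (by rw [I_spaceOp_mul_self, hv]; simp) ψ
  · rw [inner_currentY, expect_eq_of_fixed h]

/-! ### Killing spinors that are null and of type I everywhere. -/

/-- The reflection of `v` in the hyperplane orthogonal to `w ≠ 0`. -/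
noncomputable def reflect (w v : E n) : E n := v - (2 * inner ℝ v w / ‖w‖ ^ 2) • w

theorem norm_reflect {w : E n} (hw : w ≠ 0) (v : E n) : ‖reflect w v‖ = ‖v‖ := by
  have hw' : ‖w‖ ≠ 0 := norm_ne_zero_iff.2 hw
  have h : ‖reflect w v‖ ^ 2 = ‖v‖ ^ 2 := by
    rw [reflect, norm_sub_sq_real, real_inner_smul_right, norm_smul, mul_pow, Real.norm_eq_abs,
      sq_abs]
    field_simp
    ring
  exact (pow_left_inj₀ (norm_nonneg _) (norm_nonneg _) two_ne_zero).1 h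

/-- The Clifford relation `v w + w v = -2⟨v, w⟩`: the term subtracted in the reflection, multiplied
by `w`, yields exactly the scalar `2⟨v, w⟩`. -/
theorem spaceOp_reflect_mul (c : SpinorModule n S) {w : E n} (hw : w ≠ 0) (v : E n) :
    spaceOp c (reflect w v) * spaceOp c w = -(spaceOp c w * spaceOp c v) := by
  have hw' : ‖w‖ ≠ 0 := norm_ne_zero_iff.2 hw
  have h := spaceOp_anticomm c v w
  rw [reflect, spaceOp_sub, spaceOp_smul, sub_mul, smul_mul_assoc, spaceOp_mul_self, smul_neg,
    smul_smul, ← Complex.ofReal_mul, div_mul_cancel₀ _ (pow_ne_zero 2 hw')]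
  linear_combination (norm := module) h

/-- Substituting `u = 𝐢 y u` in `(1 - 𝐢 z) u` leaves a single Clifford product, which is invertible
because `y` lies on the unit sphere and `z` inside it. -/
theorem killingSpinor_of_fixed (c : SpinorModule n S) {y : E n} {u : DoubleSpinor S}
    (h : Complex.I • spaceMul c y u = u) (z : E n) :
    killingSpinor c u z =
      (((xi z ^ (-(1 / 2) : ℝ) : ℝ) : ℂ) * Complex.I) • spaceOp c (y - z) u := by
  rw [killingSpinor, mul_smul, spaceOp_sub, LinearMap.sub_apply, smul_sub Complex.I]
  simp only [spaceOp_apply]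
  rw [h]

/-- The imaginary Killing spinor of a constant spinor fixed by `x e₀` and by `𝐢 y` is null and of
type I. -/
theorem killingSpinor_null_typeI (c : SpinorModule n S) {x y : E n} (hx : ‖x‖ = 1)
    (hy : ‖y‖ = 1) {u : DoubleSpinor S} (hxu : spaceMul c x (timeMul u) = u)
    (hyu : Complex.I • spaceMul c y u = u) {z : E n} (hz : ‖z‖ < 1) :
    IsNull c (killingSpinor c u z) ∧ IsTypeI c (killingSpinor c u z) := by
  have hw : y - z ≠ 0 := by
    intro h
    rw [sub_eq_zero.1 h] at hy
    exact hz.ne hy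
  rw [killingSpinor_of_fixed c hyu]
  generalize ((xi z ^ (-(1 / 2) : ℝ) : ℝ) : ℂ) * Complex.I = r
  constructor
  -- Moving `w = y - z` to the left past `e₀` and past the reflected `x` gives two signs, which
  -- cancel.
  · refine isNull_of_fixed (x := reflect (y - z) x) (by rw [norm_reflect hw, hx]) ?_
    change (spaceOp c (reflect (y - z) x) * timeOp S) (r • spaceOp c (y - z) u) = _
    rw [map_smul, ← Module.End.mul_apply, mul_assoc, timeOp_mul_spaceOp, mul_neg, ← mul_assoc,
      spaceOp_reflect_mul c hw, neg_mul, neg_neg]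
    simp only [Module.End.mul_apply, spaceOp_apply, timeOp_apply, hxu]
  -- No `e₀` has to be passed here, so the one remaining sign is put into the direction.
  · refine isTypeI_of_fixed (y := -reflect (y - z) y) (by rw [norm_neg, norm_reflect hw, hy]) ?_
    change (Complex.I • spaceOp c (-reflect (y - z) y)) (r • spaceOp c (y - z) u) = _
    rw [map_smul, ← Module.End.mul_apply, spaceOp_neg, smul_neg, neg_mul, smul_mul_assoc,
      spaceOp_reflect_mul c hw, smul_neg, neg_neg, ← mul_smul_comm]
    simp only [Module.End.mul_apply, spaceOp_apply, LinearMap.smul_apply, hyu]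

theorem exists_fixed_spinor (c : SpinorModule n S) {x y : E n} (hx : ‖x‖ = 1)
    (hy : ‖y‖ = 1) (hxy : inner ℝ x y = (0 : ℝ)) :
    ∃ u : DoubleSpinor S, u ≠ 0 ∧ spaceMul c x (timeMul u) = u ∧
      Complex.I • spaceMul c y u = u := by
  have hanti : ∀ φ, c.cliff y (c.cliff x φ) = -c.cliff x (c.cliff y φ) := by
    intro φ
    have h := congrArg (fun T => (T (WithLp.toLp 2 (φ, (0 : S)))).fst) (spaceOp_anticomm c x y)
    simp [spaceMul, hxy] at h
    rw [eq_neg_iff_add_eq_zero, add_comm]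
    exact h
  have hxx : ∀ φ, c.cliff x (c.cliff x φ) = -φ := fun φ => by simp [c.cliff_sq, hx]
  have hyy : ∀ φ, c.cliff y (c.cliff y φ) = -φ := fun φ => by simp [c.cliff_sq, hy]
  -- Project any `w ≠ 0` to the `+1` eigenspace of `𝐢 y`. If the projection vanishes, `w` has
  -- eigenvalue `-1`, and `x`, which anticommutes with `y`, carries it to eigenvalue `+1`.
  have hex : ∃ φ : S, φ ≠ 0 ∧ Complex.I • c.cliff y φ = φ := by
    have : Nontrivial S := Module.nontrivial_of_finrank_pos (R := ℂ) (by
      rw [c.finrank_eq]; positivity)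
    obtain ⟨w, hw⟩ := exists_ne (0 : S)
    by_cases h : w + Complex.I • c.cliff y w = 0
    · refine ⟨c.cliff x w, fun h0 => hw ?_, ?_⟩
      · have := hxx w
        rwa [h0, map_zero, eq_comm, neg_eq_zero] at this
      · rw [hanti, smul_neg, ← map_smul, ← map_neg, ← eq_neg_of_add_eq_zero_left h]
    · refine ⟨_, h, ?_⟩
      rw [map_add, map_smul, hyy, smul_add, smul_smul, Complex.I_mul_I, neg_one_smul, neg_neg,
        add_comm]
  obtain ⟨φ, hφ, hyφ⟩ := hex
  -- The equation `x e₀ u = u` forces the second component to be `-x φ`. The sign of the spatial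
  -- multiplication on the second summand and `x y = -y x` then make `𝐢 y` fix it too.
  refine ⟨WithLp.toLp 2 (φ, -c.cliff x φ), fun h => hφ (congrArg WithLp.fst h), ?_, ?_⟩
  · refine WithLp.ofLp_injective 2 (Prod.ext ?_ ?_) <;> simp [spaceMul, timeMul, hxx]
  · refine WithLp.ofLp_injective 2 (Prod.ext ?_ ?_)
    · simpa [spaceMul] using hyφ
    · change Complex.I • -c.cliff y (-c.cliff x φ) = -c.cliff x φ
      rw [map_neg, neg_neg, hanti, smul_neg, ← map_smul, hyφ]

end SpinorAlgebra
end AdS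

namespace AdS
-- Lowest eigenvectors: the case without angular momentum.
section Minimization

variable {n : ℕ} {S : Type*} [NormedAddCommGroup S] [InnerProductSpace ℂ S]

/-- The quadratic form of `Q` attains its minimum on the unit sphere at every unit spinor that is
fixed by `x e₀` and by `𝐢 y`, for some orthonormal `x`, `y`. -/
def MinimizedByFixed (c : SpinorModule n S) (Q : Module.End ℂ (DoubleSpinor S)) : Prop :=
  ∃ x y : E n, ‖x‖ = 1 ∧ ‖y‖ = 1 ∧ inner ℝ x y = (0 : ℝ) ∧ ∃ m : ℝ,
    (∀ v, m * ‖v‖ ^ 2 ≤ expect Q v) ∧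
    ∀ u, spaceMul c x (timeMul u) = u → Complex.I • spaceMul c y u = u →
      expect Q u = m * ‖u‖ ^ 2

/-- A symmetric involution has expectation at most `|v|²`, with equality on its fixed vectors. The
two bounds add up, and both are sharp at a common fixed vector. -/
theorem minimizedByFixed_of_involutions {c : SpinorModule n S} {x y : E n} (hx : ‖x‖ = 1)
    (hy : ‖y‖ = 1) (hxy : inner ℝ x y = (0 : ℝ)) {T₁ T₂ : Module.End ℂ (DoubleSpinor S)}
    (h₁ : T₁.IsSymmetric) (h₂ : T₂.IsSymmetric) (h₁' : T₁ * T₁ = 1) (h₂' : T₂ * T₂ = 1)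
    (hfix : ∀ u, spaceMul c x (timeMul u) = u → Complex.I • spaceMul c y u = u →
      T₁ u = u ∧ T₂ u = u) {r s : ℝ} (hr : 0 ≤ r) (hs : 0 ≤ s)
    {Q : Module.End ℂ (DoubleSpinor S)} (hQ : Q = -((r : ℂ) • T₁ + (s : ℂ) • T₂)) :
    MinimizedByFixed c Q := by
  refine ⟨x, y, hx, hy, hxy, -(r + s), fun v => ?_, fun u hxu hyu => ?_⟩
  · have e₁ := mul_le_mul_of_nonneg_left (expect_le_of_symmetric_involution h₁ h₁' v) hr
    have e₂ := mul_le_mul_of_nonneg_left (expect_le_of_symmetric_involution h₂ h₂' v) hs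
    rw [hQ, expect_neg, expect_add, expect_smul, expect_smul]
    linarith
  · obtain ⟨f₁, f₂⟩ := hfix u hxu hyu
    rw [hQ, expect_neg, expect_add, expect_smul, expect_smul, expect_eq_of_fixed f₁,
      expect_eq_of_fixed f₂]
    ring

theorem exists_polar (p q : ℝ) :
    ∃ r θ : ℝ, 0 ≤ r ∧ p = r * Real.cos θ ∧ q = r * Real.sin θ :=
  ⟨‖(⟨p, q⟩ : ℂ)‖, Complex.arg ⟨p, q⟩, norm_nonneg _,
    (Complex.norm_mul_cos_arg ⟨p, q⟩).symm, (Complex.norm_mul_sin_arg ⟨p, q⟩).symm⟩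

theorem exists_unit_orthogonal (hn : 2 ≤ n) (v : E n) :
    ∃ w : E n, ‖w‖ = 1 ∧ inner ℝ v w = (0 : ℝ) := by
  have h1 := Submodule.finrank_add_finrank_orthogonal (ℝ ∙ v)
  have h2 : Module.finrank ℝ (ℝ ∙ v) ≤ 1 := by
    simpa using finrank_span_le_card (R := ℝ) ({v} : Set (E n))
  rw [finrank_euclideanSpace_fin] at h1
  have : Nontrivial (ℝ ∙ v)ᗮ := Module.nontrivial_of_finrank_pos (R := ℝ) (by omega)
  obtain ⟨⟨w, hw⟩, hw0⟩ := exists_ne (0 : (ℝ ∙ v)ᗮ)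
  have hw0' : w ≠ 0 := fun h => hw0 (Subtype.ext h)
  refine ⟨‖w‖⁻¹ • w, by simp [norm_smul, hw0'], ?_⟩
  rw [real_inner_smul_right, Submodule.mem_orthogonal_singleton_iff_inner_right.1 hw, mul_zero]

/-- A direction is needed even when `v = 0`; this is where two dimensions are required. The minus
sign matches the form `-(r T₁ + s T₂)` aimed at. -/
theorem exists_unit_multiple_orthogonal (hn : 2 ≤ n) {v w : E n} (h : inner ℝ v w = (0 : ℝ)) :
    ∃ (v' : E n) (r : ℝ), ‖v'‖ = 1 ∧ 0 ≤ r ∧ v = -(r • v') ∧ inner ℝ v' w = (0 : ℝ) := by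
  rcases eq_or_ne v 0 with rfl | hv
  · obtain ⟨v', h1, h2⟩ := exists_unit_orthogonal hn w
    exact ⟨v', 0, h1, le_rfl, by simp, by rwa [real_inner_comm]⟩
  · refine ⟨-(‖v‖⁻¹ • v), ‖v‖, by simp [norm_smul, hv], norm_nonneg v, ?_, ?_⟩
    · rw [smul_neg, neg_neg, smul_smul, mul_inv_cancel₀ (norm_ne_zero_iff.2 hv), one_smul]
    · rw [inner_neg_left, real_inner_smul_left, h, mul_zero, neg_zero]

/-- Singular value decomposition of a pair of vectors. -/
theorem exists_rotation_orthonormal (hn : 2 ≤ n) (P C : E n) :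
    ∃ (θ r s : ℝ) (v w : E n), 0 ≤ r ∧ 0 ≤ s ∧ ‖v‖ = 1 ∧ ‖w‖ = 1 ∧ inner ℝ v w = (0 : ℝ) ∧
      P = -((r * Real.cos θ) • v - (s * Real.sin θ) • w) ∧
      C = -((r * Real.sin θ) • v + (s * Real.cos θ) • w) := by
  -- Rotating the pair `(P, C)` by `θ` gives vectors with inner product `cos 2θ ⟨P, C⟩ - sin 2θ
  -- (|P|² - |C|²) / 2`. It vanishes when `2θ` is the polar angle of these two numbers.
  obtain ⟨ρ, φ, -, h1, h2⟩ := exists_polar (‖P‖ ^ 2 - ‖C‖ ^ 2) (2 * inner ℝ P C)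
  obtain ⟨θ, rfl⟩ : ∃ θ, φ = 2 * θ := ⟨φ / 2, by ring⟩
  have hcs := Real.cos_sq_add_sin_sq θ
  rw [Real.cos_two_mul'] at h1
  rw [Real.sin_two_mul] at h2
  have horth : inner ℝ (Real.cos θ • P + Real.sin θ • C)
      (-(Real.sin θ) • P + Real.cos θ • C) = (0 : ℝ) := by
    simp only [inner_add_left, inner_add_right, real_inner_smul_left, real_inner_smul_right,
      real_inner_self_eq_norm_sq, real_inner_comm P C]
    linear_combination (-(Real.cos θ * Real.sin θ)) * h1
      + ((Real.cos θ ^ 2 - Real.sin θ ^ 2) / 2) * h2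
  obtain ⟨w, s, hw, hs, hsw, how⟩ := exists_unit_multiple_orthogonal hn
    ((real_inner_comm _ _).trans horth)
  obtain ⟨v, r, hv, hr, hrv, hov⟩ := exists_unit_multiple_orthogonal hn
    ((real_inner_comm _ _).trans how)
  refine ⟨θ, r, s, v, w, hr, hs, hv, hw, hov, ?_, ?_⟩
  · calc P = (Real.cos θ ^ 2 + Real.sin θ ^ 2) • P := by rw [hcs, one_smul]
      _ = Real.cos θ • (Real.cos θ • P + Real.sin θ • C)
          - Real.sin θ • (-(Real.sin θ) • P + Real.cos θ • C) := by module
      _ = _ := by rw [hrv, hsw]; module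
  · calc C = (Real.cos θ ^ 2 + Real.sin θ ^ 2) • C := by rw [hcs, one_smul]
      _ = Real.sin θ • (Real.cos θ • P + Real.sin θ • C)
          + Real.cos θ • (-(Real.sin θ) • P + Real.cos θ • C) := by module
      _ = _ := by rw [hrv, hsw]; module

theorem smul_add_smul_mul_self {A : Type*} [Ring A] [Algebra ℂ A] {V W : A} {p r s : ℂ}
    (hV : V * V = 1) (hW : W * W = r • 1) (hVW : V * W + W * V = 0) (h : p ^ 2 + s ^ 2 * r = 1) :
    (p • V + s • W) * (p • V + s • W) = 1 := by
  have hWV : W * V = -(V * W) := by rw [eq_neg_iff_add_eq_zero, add_comm]; exact hVW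
  simp only [mul_add, add_mul, smul_mul_smul_comm, hV, hW, hWV, smul_smul, smul_neg]
  trans (p ^ 2 + s ^ 2 * r) • (1 : A)
  · module
  · rw [h, one_smul]

theorem spaceOp_anticomm_of_orthogonal (c : SpinorModule n S) {v w : E n}
    (h : inner ℝ v w = (0 : ℝ)) : spaceOp c v * spaceOp c w = -(spaceOp c w * spaceOp c v) := by
  rw [eq_neg_iff_add_eq_zero, spaceOp_anticomm, h]
  simp

theorem spaceOp_mul_self_of_unit (c : SpinorModule n S) {v : E n} (h : ‖v‖ = 1) :
    spaceOp c v * spaceOp c v = -1 := by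
  rw [spaceOp_mul_self, h]
  simp

/-- With the decomposition by `v`, `w` and `θ`, the involutions are `T₁ = cos θ 𝐢 v + sin θ v e₀`
and `T₂ = -sin θ 𝐢 w + cos θ w e₀`. Undoing the rotation by `θ` gives `y = cos θ v - sin θ w` and `x
= sin θ v + cos θ w`. -/
theorem minimizedByFixed_vectors (hn : 2 ≤ n) (c : SpinorModule n S) (P C : E n) :
    MinimizedByFixed c (Complex.I • spaceOp c P + spaceOp c C * timeOp S) := by
  obtain ⟨θ, r, s, v, w, hr, hs, hv, hw, hvw, hP, hC⟩ := exists_rotation_orthonormal hn P C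
  have hcs := Real.cos_sq_add_sin_sq θ
  have hinv : ∀ (a b : ℝ) (v : E n), ‖v‖ = 1 → a ^ 2 + b ^ 2 = 1 →
      ((a : ℂ) • (Complex.I • spaceOp c v) + (b : ℂ) • (spaceOp c v * timeOp S)) *
      ((a : ℂ) • (Complex.I • spaceOp c v) + (b : ℂ) • (spaceOp c v * timeOp S)) = 1 := by
    intro a b v hv hab
    refine smul_add_smul_mul_self (r := 1) ?_ ?_ ?_ (by rw [mul_one]; exact_mod_cast hab)
    · rw [I_spaceOp_mul_self, hv]; simp
    · rw [spaceOp_timeOp_mul_self, hv]; simp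
    · rw [smul_mul_assoc, mul_smul_comm, mul_assoc, timeOp_mul_spaceOp]
      simp
  have hsymm : ∀ (a b : ℝ) (v : E n),
      ((a : ℂ) • (Complex.I • spaceOp c v) + (b : ℂ) • (spaceOp c v * timeOp S)).IsSymmetric :=
    fun a b v => (isSymmetric_real_smul (isSymmetric_I_spaceOp c v) a).add
      (isSymmetric_real_smul (isSymmetric_spaceOp_mul_timeOp c v) b)
  have hx : ‖Real.sin θ • v + Real.cos θ • w‖ = 1 := by
    rw [← pow_eq_one_iff_of_nonneg (norm_nonneg _) two_ne_zero,
      norm_add_sq_real, real_inner_smul_left, real_inner_smul_right, hvw, norm_smul, norm_smul, hv,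
      hw]
    simp
  have hy : ‖Real.cos θ • v - Real.sin θ • w‖ = 1 := by
    rw [← pow_eq_one_iff_of_nonneg (norm_nonneg _) two_ne_zero,
      norm_sub_sq_real, real_inner_smul_left, real_inner_smul_right, hvw, norm_smul, norm_smul, hv,
      hw]
    simp
  have hxy : inner ℝ (Real.sin θ • v + Real.cos θ • w) (Real.cos θ • v - Real.sin θ • w)
      = (0 : ℝ) := by
    simp only [inner_add_left, inner_sub_right, real_inner_smul_left, real_inner_smul_right,
      real_inner_self_eq_norm_sq, real_inner_comm v w, hvw, hv, hw]
    ring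
  -- On `u` one has `𝐢 u = -y u` and `e₀ u = -x u`, so for `v = a y + b x` the operator acts as `-v
  -- v = 1`.
  have hfix : ∀ (x y : E n) (u : DoubleSpinor S), ‖x‖ = 1 → spaceMul c x (timeMul u) = u →
      ‖y‖ = 1 → Complex.I • spaceMul c y u = u → ∀ (a b : ℝ) (v : E n), ‖v‖ = 1 →
      v = a • y + b • x →
      ((a : ℂ) • (Complex.I • spaceOp c v) + (b : ℂ) • (spaceOp c v * timeOp S)) u = u := by
    intro x y u hx hxu hy hyu a b v hv hvab
    have e1 : Complex.I • u = -spaceOp c y u := by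
      rw [eq_neg_iff_add_eq_zero]
      nth_rw 1 [← hyu]
      rw [smul_smul, Complex.I_mul_I, neg_one_smul]
      exact neg_add_cancel _
    have e2 : timeOp S u = -spaceOp c x u := by
      conv_rhs => rw [← hxu]
      rw [spaceOp_apply, spaceMul_sq, hx]
      simp
    calc _ = spaceOp c v ((a : ℂ) • (Complex.I • u) + (b : ℂ) • timeOp S u) := by
          simp [map_add]
      _ = spaceOp c v (-spaceOp c v u) := by
          rw [e1, e2]
          congr 1
          conv_rhs => rw [hvab, spaceOp_add, spaceOp_smul, spaceOp_smul]
          simp only [LinearMap.add_apply, LinearMap.smul_apply, smul_neg]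
          abel
      _ = u := by
          rw [map_neg, spaceOp_apply, spaceOp_apply, spaceMul_sq, hv]
          simp
  refine minimizedByFixed_of_involutions hx hy hxy (hsymm (Real.cos θ) (Real.sin θ) v)
    (hsymm (-Real.sin θ) (Real.cos θ) w) (hinv _ _ v hv hcs)
    (hinv _ _ w hw (by linarith [hcs])) (fun u hxu hyu =>
      ⟨hfix _ _ u hx hxu hy hyu _ _ v hv ?_, hfix _ _ u hx hxu hy hyu _ _ w hw ?_⟩) hr hs ?_
  · calc v = (Real.cos θ ^ 2 + Real.sin θ ^ 2) • v := by rw [hcs, one_smul]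
      _ = _ := by module
  · calc w = (Real.cos θ ^ 2 + Real.sin θ ^ 2) • w := by rw [hcs, one_smul]
      _ = _ := by module
  · rw [hP, hC]
    simp only [spaceOp_neg, spaceOp_add, spaceOp_sub, spaceOp_smul, add_mul, neg_mul,
      smul_mul_assoc]
    push_cast
    module

/-! ### Lowest eigenvectors: simple angular momentum. -/

/-- The involution `𝐢 e f e₀`. -/
noncomputable def rotOp (c : SpinorModule n S) (e f : E n) : Module.End ℂ (DoubleSpinor S) :=
  Complex.I • (spaceOp c e * spaceOp c f * timeOp S)

theorem rotOp_mul_self (c : SpinorModule n S) {e f : E n} (he : ‖e‖ = 1) (hf : ‖f‖ = 1)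
    (hef : inner ℝ e f = (0 : ℝ)) : rotOp c e f * rotOp c e f = 1 := by
  have h1 := spaceOp_anticomm_of_orthogonal c hef
  have h2 := spaceOp_mul_self_of_unit c he
  have h3 := spaceOp_mul_self_of_unit c hf
  have h4 := timeOp_mul_spaceOp c e
  have h5 := timeOp_mul_spaceOp c f
  have h6 := timeOp_mul_self (S := S)
  rw [rotOp, smul_mul_smul_comm, Complex.I_mul_I, neg_one_smul]
  generalize spaceOp c e = A at *
  generalize spaceOp c f = B at *
  generalize timeOp S = Z at *
  calc -(A * B * Z * (A * B * Z)) = -(A * B * (Z * A) * B * Z) := by noncomm_ring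
    _ = (A * B) * A * (Z * B) * Z := by rw [h4]; noncomm_ring
    _ = (A * B) * A * -(B * Z) * Z := by rw [h5]
    _ = B * (A * A) * B * (Z * Z) := by rw [h1]; noncomm_ring
    _ = 1 := by rw [h2, h6, mul_neg_one, neg_mul, h3]; simp

theorem isSymmetric_rotOp (c : SpinorModule n S) {e f : E n} (hef : inner ℝ e f = (0 : ℝ)) :
    (rotOp c e f).IsSymmetric := by
  intro ψ χ
  have h4 := timeOp_mul_spaceOp c e
  have h5 := timeOp_mul_spaceOp c f
  have h1 := spaceOp_anticomm_of_orthogonal c hef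
  have h : timeOp S * spaceOp c f * spaceOp c e = -(spaceOp c e * spaceOp c f * timeOp S) := by
    rw [h5, neg_mul, mul_assoc, h4, mul_neg, neg_neg, h1, neg_mul, neg_neg, mul_assoc]
  have h' := LinearMap.congr_fun h χ
  simp only [Module.End.mul_apply, LinearMap.neg_apply, spaceOp_apply, timeOp_apply] at h'
  simp only [rotOp, LinearMap.smul_apply, Module.End.mul_apply, spaceOp_apply, timeOp_apply,
    inner_smul_left, inner_smul_right, inner_spaceMul_left, inner_timeMul_left, h', Complex.conj_I,
    inner_neg_right]
  ring

/-- Moving `h` past the three factors `e`, `f`, `e₀` gives three signs. -/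
theorem rotOp_anticomm_I_spaceOp (c : SpinorModule n S) {e f h : E n}
    (he : inner ℝ e h = (0 : ℝ)) (hf : inner ℝ f h = (0 : ℝ)) :
    rotOp c e f * (Complex.I • spaceOp c h) + (Complex.I • spaceOp c h) * rotOp c e f = 0 := by
  have h1 := spaceOp_anticomm_of_orthogonal c he
  have h2 := spaceOp_anticomm_of_orthogonal c hf
  have h3 := timeOp_mul_spaceOp c h
  rw [rotOp, smul_mul_smul_comm, smul_mul_smul_comm, ← smul_add]
  have : spaceOp c e * spaceOp c f * timeOp S * spaceOp c h =
      -(spaceOp c h * (spaceOp c e * spaceOp c f * timeOp S)) := by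
    generalize spaceOp c e = A at *
    generalize spaceOp c f = B at *
    generalize timeOp S = Z at *
    generalize spaceOp c h = H at *
    calc A * B * Z * H = A * B * (Z * H) := by noncomm_ring
      _ = -(A * (B * H) * Z) := by rw [h3]; noncomm_ring
      _ = A * H * B * Z := by rw [h2]; noncomm_ring
      _ = _ := by rw [h1]; noncomm_ring
  rw [this, neg_add_cancel, smul_zero]

theorem rotOp_anticomm_spaceOp_timeOp (c : SpinorModule n S) {e f h : E n}
    (he : inner ℝ e h = (0 : ℝ)) (hf : inner ℝ f h = (0 : ℝ)) :
    rotOp c e f * (spaceOp c h * timeOp S) + (spaceOp c h * timeOp S) * rotOp c e f = 0 := by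
  have h1 := rotOp_anticomm_I_spaceOp c he hf
  have h2 : timeOp S * rotOp c e f = rotOp c e f * timeOp S := by
    rw [rotOp, mul_smul_comm, smul_mul_assoc]
    congr 1
    rw [← mul_assoc, ← mul_assoc, timeOp_mul_spaceOp, neg_mul, mul_assoc _ (timeOp S),
      timeOp_mul_spaceOp, mul_neg, neg_neg]
    simp only [mul_assoc]
  rw [mul_smul_comm, smul_mul_assoc, ← smul_add, smul_eq_zero] at h1
  rw [mul_assoc, h2, ← mul_assoc, ← mul_assoc, ← add_mul,
    h1.resolve_left Complex.I_ne_zero, zero_mul]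

/-- Splitting of a vector along a plane `e ∧ f`, with the plane rotated such that the tangential
part is a non-positive multiple of `e'`, and oriented at will. -/
theorem exists_adapted_frame {e f : E n} (he : ‖e‖ = 1) (hf : ‖f‖ = 1)
    (hef : inner ℝ e f = (0 : ℝ)) (a : ℝ) (P : E n) (c : SpinorModule n S) :
    ∃ (e' f' h : E n) (p b : ℝ), ‖e'‖ = 1 ∧ ‖f'‖ = 1 ∧ inner ℝ e' f' = (0 : ℝ) ∧
      inner ℝ e' h = (0 : ℝ) ∧ inner ℝ f' h = (0 : ℝ) ∧ 0 ≤ p ∧ 0 ≤ b ∧ P = -(p • e' + h) ∧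
      (a : ℂ) • rotOp c e f = -((b : ℂ) • rotOp c e' f') := by
  -- Polar coordinates of the tangential part of `-P`; the new first vector points along it.
  obtain ⟨r, θ, hr, h1, h2⟩ := exists_polar (-inner ℝ e P) (-inner ℝ f P)
  have hcs := Real.cos_sq_add_sin_sq θ
  have hfe : inner ℝ f e = (0 : ℝ) := by rwa [real_inner_comm]
  have hee : inner ℝ e e = (1 : ℝ) := by rw [real_inner_self_eq_norm_sq, he, one_pow]
  have hff : inner ℝ f f = (1 : ℝ) := by rw [real_inner_self_eq_norm_sq, hf, one_pow]
  -- For orthonormal vectors the Clifford product depends only on the oriented plane, so rotating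
  -- the frame does not change it.
  have hrot : rotOp c (Real.cos θ • e + Real.sin θ • f) (-Real.sin θ • e + Real.cos θ • f) =
      rotOp c e f := by
    have g1 := spaceOp_anticomm_of_orthogonal c hfe
    have g2 := spaceOp_mul_self_of_unit c he
    have g3 := spaceOp_mul_self_of_unit c hf
    have hcs' : ((Real.cos θ : ℝ) : ℂ) ^ 2 + ((Real.sin θ : ℝ) : ℂ) ^ 2 = 1 := by
      exact_mod_cast hcs
    rw [rotOp, rotOp]
    congr 2
    simp only [spaceOp_add, spaceOp_smul, mul_add, add_mul, smul_mul_smul_comm, g1, g2, g3]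
    trans (((Real.cos θ : ℝ) : ℂ) ^ 2 + ((Real.sin θ : ℝ) : ℂ) ^ 2) •
      (spaceOp c e * spaceOp c f)
    · push_cast
      module
    · rw [hcs', one_smul]
  have hne : ‖Real.cos θ • e + Real.sin θ • f‖ = 1 := by
    rw [norm_eq_sqrt_real_inner, Real.sqrt_eq_one]
    simp only [inner_add_left, inner_add_right, real_inner_smul_left, real_inner_smul_right, hee,
      hff, hef, hfe]
    linear_combination hcs
  have hnf : ‖-Real.sin θ • e + Real.cos θ • f‖ = 1 := by
    rw [norm_eq_sqrt_real_inner, Real.sqrt_eq_one]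
    simp only [inner_add_left, inner_add_right, real_inner_smul_left, real_inner_smul_right, hee,
      hff, hef, hfe]
    linear_combination hcs
  have hoef : inner ℝ (Real.cos θ • e + Real.sin θ • f) (-Real.sin θ • e + Real.cos θ • f)
      = (0 : ℝ) := by
    simp only [inner_add_left, inner_add_right, real_inner_smul_left, real_inner_smul_right, hee,
      hff, hef, hfe]
    ring
  have hoe : inner ℝ (Real.cos θ • e + Real.sin θ • f)
      (-P - r • (Real.cos θ • e + Real.sin θ • f)) = (0 : ℝ) := by
    simp only [inner_add_left, inner_sub_right, inner_neg_right, inner_add_right,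
      real_inner_smul_left, real_inner_smul_right, hee, hff, hef, hfe]
    linear_combination Real.cos θ * h1 + Real.sin θ * h2
  have hof : inner ℝ (-Real.sin θ • e + Real.cos θ • f)
      (-P - r • (Real.cos θ • e + Real.sin θ • f)) = (0 : ℝ) := by
    simp only [inner_add_left, inner_sub_right, inner_neg_right, inner_add_right,
      real_inner_smul_left, real_inner_smul_right, hee, hff, hef, hfe]
    linear_combination -Real.sin θ * h1 + Real.cos θ * h2
  -- The sign of `a` is absorbed by reversing the second frame vector, which reverses the
  -- orientation of the plane.
  rcases le_total a 0 with ha | ha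
  · refine ⟨_, _, _, r, -a, hne, hnf, hoef, hoe, hof, hr, by linarith, by module, ?_⟩
    rw [hrot]
    push_cast
    module
  · refine ⟨_, -(-Real.sin θ • e + Real.cos θ • f), _, r, a, hne, by rwa [norm_neg],
      by rw [inner_neg_right, hoef, neg_zero], hoe, by rw [inner_neg_left, hof, neg_zero], hr, ha,
      by module, ?_⟩
    rw [← hrot, rotOp, rotOp, spaceOp_neg]
    simp

/-- Splitting of the weights that occur in `p A + b V + H` for commuting `A`, `V` that both
anticommute with `H`. -/
theorem exists_weights {p b : ℝ} (hp : 0 ≤ p) (hb : 0 ≤ b) {e h : E n}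
    (heh : inner ℝ e h = (0 : ℝ)) : ∃ (r s q : ℝ) (k : E n), 0 ≤ r ∧ 0 ≤ s ∧
      p = r * q ∧ b = s * q ∧ h = (r + s) • k ∧ q ^ 2 + ‖k‖ ^ 2 = 1 ∧
      inner ℝ e k = (0 : ℝ) ∧ (∀ v : E n, inner ℝ v h = (0 : ℝ) → inner ℝ v k = (0 : ℝ)) := by
  have hpb : 0 ≤ p + b := add_nonneg hp hb
  rcases eq_or_lt_of_le hpb with h0 | h0
  -- With both commuting weights zero only `h` is left, so `q = 0` and `k` is the unit vector along
  -- `h`; if `h = 0` as well, both `r` and `s` vanish.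
  · have hp0 : p = 0 := by linarith
    have hb0 : b = 0 := by linarith
    rcases eq_or_ne h 0 with rfl | hh
    · exact ⟨0, 0, 1, 0, le_rfl, le_rfl, by simp [hp0], by simp [hb0], by simp, by simp, by simp,
        by simp⟩
    · have hh' := norm_ne_zero_iff.2 hh
      exact ⟨‖h‖, 0, 0, ‖h‖⁻¹ • h, norm_nonneg h, le_rfl, by simp [hp0], by simp [hb0],
        by rw [add_zero, smul_smul, mul_inv_cancel₀ hh', one_smul],
        by simp [norm_smul, hh], by rw [real_inner_smul_right, heh, mul_zero],
        fun v hv => by rw [real_inner_smul_right, hv, mul_zero]⟩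
  -- The value of `r + s`: the identities `(r + s) q = p + b` and `(r + s) k = h` with `q² + |k|² =
  -- 1` force it. It is then shared out in the ratio `p : b`.
  · set m := √((p + b) ^ 2 + ‖h‖ ^ 2) with hm
    have hm2 : m ^ 2 = (p + b) ^ 2 + ‖h‖ ^ 2 := Real.sq_sqrt (by positivity)
    have hm0 : 0 < m := Real.sqrt_pos.2 (by positivity)
    have hs : p * m / (p + b) + b * m / (p + b) = m := by field_simp
    refine ⟨p * m / (p + b), b * m / (p + b), (p + b) / m, m⁻¹ • h, by positivity, by positivity,
      by field_simp, by field_simp, ?_, ?_, by rw [real_inner_smul_right, heh, mul_zero],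
        fun v hv => by rw [real_inner_smul_right, hv, mul_zero]⟩
    · rw [hs, smul_smul, mul_inv_cancel₀ hm0.ne', one_smul]
    · rw [norm_smul, mul_pow, Real.norm_eq_abs, sq_abs]
      field_simp
      exact hm2.symm

theorem norm_smul_add_eq_one {e k : E n} {q : ℝ} (he : ‖e‖ = 1) (hek : inner ℝ e k = (0 : ℝ))
    (hq : q ^ 2 + ‖k‖ ^ 2 = 1) : ‖q • e + k‖ = 1 := by
  have : ‖q • e + k‖ ^ 2 = 1 := by
    rw [norm_add_sq_real, real_inner_smul_left, hek, norm_smul, he, mul_pow, Real.norm_eq_abs,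
      sq_abs]
    linarith
  exact (pow_eq_one_iff_of_nonneg (norm_nonneg _) two_ne_zero).1 this

/-- In the adapted frame the operator is `-(p 𝐢 e' + 𝐢 h + b V)` with `V = 𝐢 e' f' e₀`. The weights
distribute the normal term over the other two: `T₁ = 𝐢 (q e' + k)` and `T₂ = q V + 𝐢 k`. The choice
`x = f'` makes `V` act on `u` as `𝐢 e'`, so that `T₂ u = T₁ u`. -/
theorem minimizedByFixed_linMom_simple (c : SpinorModule n S) (P : E n) {e f : E n}
    (he : ‖e‖ = 1) (hf : ‖f‖ = 1) (hef : inner ℝ e f = (0 : ℝ)) (a : ℝ) :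
    MinimizedByFixed c (Complex.I • spaceOp c P + (a : ℂ) • rotOp c e f) := by
  obtain ⟨e', f', h, p, b, he', hf', hef', heh, hfh, hp, hb, rfl, hrot⟩ :=
    exists_adapted_frame he hf hef a P c
  obtain ⟨r, s, q, k, hr, hs, rfl, rfl, rfl, hq, hek, hk⟩ := exists_weights hp hb heh
  have hfk := hk f' hfh
  have hy : ‖q • e' + k‖ = 1 := norm_smul_add_eq_one he' hek hq
  refine minimizedByFixed_of_involutions (x := f') (y := q • e' + k)
    (T₁ := Complex.I • spaceOp c (q • e' + k))
    (T₂ := (q : ℂ) • rotOp c e' f' + (1 : ℂ) • (Complex.I • spaceOp c k)) hf' hy ?_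
    (isSymmetric_I_spaceOp c _) ?_ ?_ ?_ (fun u hxu hyu => ⟨hyu, ?_⟩) hr hs ?_
  · rw [inner_add_right, real_inner_smul_right, real_inner_comm, hef', hfk]; simp
  · rw [one_smul]
    exact (isSymmetric_real_smul (isSymmetric_rotOp c hef') q).add (isSymmetric_I_spaceOp c k)
  · rw [I_spaceOp_mul_self, hy]; simp
  · refine smul_add_smul_mul_self (rotOp_mul_self c he' hf' hef') (I_spaceOp_mul_self c k)
      (rotOp_anticomm_I_spaceOp c hek hfk) ?_
    rw [one_pow, one_mul]; exact_mod_cast hq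
  · have hV : rotOp c e' f' u = Complex.I • spaceOp c e' u := by
      simp only [rotOp, LinearMap.smul_apply, Module.End.mul_apply, spaceOp_apply, timeOp_apply,
        hxu]
    have hyu' : (Complex.I • spaceOp c (q • e' + k)) u = u := hyu
    conv_rhs => rw [← hyu']
    rw [spaceOp_add, spaceOp_smul, smul_add]
    simp only [LinearMap.add_apply, LinearMap.smul_apply, hV, one_smul]
    rw [smul_comm]
  · rw [hrot, spaceOp_neg, spaceOp_add, spaceOp_smul, spaceOp_smul, spaceOp_add, spaceOp_smul]
    push_cast
    module

/-- The same splitting with the roles of `𝐢 v` and `v e₀` exchanged. Writing `𝐢 e' f' e₀ = (e' e₀)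
(-𝐢 f')` shows that `y = -f'` makes the rotation term act on `u` as `e' e₀`. -/
theorem minimizedByFixed_center_simple (c : SpinorModule n S) (C : E n) {e f : E n}
    (he : ‖e‖ = 1) (hf : ‖f‖ = 1) (hef : inner ℝ e f = (0 : ℝ)) (a : ℝ) :
    MinimizedByFixed c (spaceOp c C * timeOp S + (a : ℂ) • rotOp c e f) := by
  obtain ⟨e', f', h, p, b, he', hf', hef', heh, hfh, hp, hb, rfl, hrot⟩ :=
    exists_adapted_frame he hf hef a C c
  obtain ⟨r, s, q, k, hr, hs, rfl, rfl, rfl, hq, hek, hk⟩ := exists_weights hp hb heh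
  have hfk := hk f' hfh
  have hx : ‖q • e' + k‖ = 1 := norm_smul_add_eq_one he' hek hq
  refine minimizedByFixed_of_involutions (x := q • e' + k) (y := -f')
    (T₁ := spaceOp c (q • e' + k) * timeOp S)
    (T₂ := (q : ℂ) • rotOp c e' f' + (1 : ℂ) • (spaceOp c k * timeOp S)) hx
    (by rwa [norm_neg]) ?_
    (isSymmetric_spaceOp_mul_timeOp c _) ?_ ?_ ?_ (fun u hxu hyu => ⟨hxu, ?_⟩) hr hs ?_
  · rw [inner_neg_right, inner_add_left, real_inner_smul_left, hef', real_inner_comm, hfk]; simp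
  · rw [one_smul]
    exact (isSymmetric_real_smul (isSymmetric_rotOp c hef') q).add
      (isSymmetric_spaceOp_mul_timeOp c k)
  · rw [spaceOp_timeOp_mul_self, hx]; simp
  · refine smul_add_smul_mul_self (rotOp_mul_self c he' hf' hef') (spaceOp_timeOp_mul_self c k)
      (rotOp_anticomm_spaceOp_timeOp c hek hfk) ?_
    rw [one_pow, one_mul]; exact_mod_cast hq
  · have hV : rotOp c e' f' u = spaceOp c e' (timeOp S u) := by
      have h1 : rotOp c e' f' = spaceOp c e' * timeOp S * (Complex.I • spaceOp c (-f')) := by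
        rw [rotOp, mul_smul_comm, spaceOp_neg, mul_neg, mul_assoc (spaceOp c e') (timeOp S),
          timeOp_mul_spaceOp, mul_neg, neg_neg, mul_assoc]
      rw [h1]
      simp only [LinearMap.smul_apply, Module.End.mul_apply, spaceOp_apply, timeOp_apply, hyu]
    have hxu' : (spaceOp c (q • e' + k) * timeOp S) u = u := hxu
    conv_rhs => rw [← hxu']
    rw [spaceOp_add, spaceOp_smul, add_mul]
    simp only [LinearMap.add_apply, LinearMap.smul_apply, Module.End.mul_apply, hV, one_smul]
  · rw [hrot, spaceOp_neg, spaceOp_add, spaceOp_smul, spaceOp_smul, spaceOp_add, spaceOp_smul]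
    simp only [add_mul, neg_mul, smul_mul_assoc]
    push_cast
    module

/-- The endomorphism `𝐢/2 (e_j e_i - e_i e_j) e₀`. -/
noncomputable def rotGen (c : SpinorModule n S) (i j : Fin n) : Module.End ℂ (DoubleSpinor S) :=
  (Complex.I / 2) • ((spaceOp c (stdVec j) * spaceOp c (stdVec i)
    - spaceOp c (stdVec i) * spaceOp c (stdVec j)) * timeOp S)

/-- The sum over all ordered pairs counts each plane twice, whence the factor `2`; the sign comes
from the order `e_j e_i` in `rotGen`. -/
theorem sum_wedge_rotGen (c : SpinorModule n S) {e f : E n} (hef : inner ℝ e f = (0 : ℝ))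
    (a : ℝ) : ∑ i, ∑ j, ((a * (e i * f j - e j * f i) : ℝ) : ℂ) • rotGen c i j =
      ((-(2 * a) : ℝ) : ℂ) • rotOp c e f := by
  have hpair : ∀ v w : E n, ∑ i, ∑ j, ((v i : ℂ) * w j) •
      (spaceOp c (stdVec i) * spaceOp c (stdVec j)) = spaceOp c v * spaceOp c w := by
    intro v w
    rw [spaceOp_eq_sum c v, spaceOp_eq_sum c w, Finset.sum_mul_sum]
    simp only [smul_mul_smul_comm]
  have hpair' : ∀ v w : E n, ∑ i, ∑ j, ((v i : ℂ) * w j) •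
      (spaceOp c (stdVec j) * spaceOp c (stdVec i)) = spaceOp c w * spaceOp c v := by
    intro v w
    rw [← hpair, Finset.sum_comm]
    simp only [mul_comm]
  have hsum : ∑ i, ∑ j, ((a * (e i * f j - e j * f i) : ℝ) : ℂ) • rotGen c i j =
      ((a : ℂ) * (Complex.I / 2)) •
      ((∑ i, ∑ j, ((e i : ℂ) * f j) • (spaceOp c (stdVec j) * spaceOp c (stdVec i))
      - ∑ i, ∑ j, ((e i : ℂ) * f j) • (spaceOp c (stdVec i) * spaceOp c (stdVec j))
      - ∑ i, ∑ j, ((f i : ℂ) * e j) • (spaceOp c (stdVec j) * spaceOp c (stdVec i))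
      + ∑ i, ∑ j, ((f i : ℂ) * e j) • (spaceOp c (stdVec i) * spaceOp c (stdVec j))) *
      timeOp S) := by
    simp only [← Finset.sum_sub_distrib, ← Finset.sum_add_distrib, Finset.sum_mul,
      Finset.smul_sum]
    refine Finset.sum_congr rfl fun i _ => Finset.sum_congr rfl fun j _ => ?_
    simp only [rotGen, add_mul, sub_mul, smul_mul_assoc]
    push_cast
    module
  rw [hsum, hpair, hpair, hpair', hpair', rotOp]
  have hfe := spaceOp_anticomm_of_orthogonal c (v := f) (w := e) (by rwa [real_inner_comm])
  rw [hfe]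
  simp only [add_mul, sub_mul, neg_mul]
  push_cast
  module

end Minimization
end AdS

namespace AdS
-- Regularity and linearity of the flux integrals.
section Flux

open MeasureTheory Filter

variable {n : ℕ}

theorem norm_ballRadius_lt_one {R : ℝ} : |ballRadius R| < 1 := by
  have h1 : |R| < 1 + √(1 + R ^ 2) := by
    have := Real.abs_le_sqrt (show R ^ 2 ≤ 1 + R ^ 2 by linarith)
    linarith
  have h2 : 0 < 1 + √(1 + R ^ 2) := by positivity
  rw [ballRadius, abs_div, abs_of_pos h2, div_lt_one h2]
  exact h1

theorem areaRadius_ballRadius_smul {R : ℝ} (hR : 0 ≤ R) {σ : E n} (hσ : ‖σ‖ = 1) :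
    areaRadius (ballRadius R • σ) = R := by
  have hs : √(1 + R ^ 2) ^ 2 = 1 + R ^ 2 := Real.sq_sqrt (by positivity)
  have h2 : 0 < 1 + √(1 + R ^ 2) := by positivity
  have h0 : 0 ≤ ballRadius R := div_nonneg hR h2.le
  have h3 : 1 - ballRadius R ^ 2 = 2 / (1 + √(1 + R ^ 2)) := by
    rw [ballRadius]
    field_simp
    linear_combination hs
  rw [areaRadius, norm_smul, hσ, mul_one, Real.norm_of_nonneg h0, h3, ballRadius]
  field_simp

theorem ballRadius_smul_mem_ball (R : ℝ) {σ : E n} (hσ : ‖σ‖ = 1) :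
    ballRadius R • σ ∈ Metric.ball (0 : E n) 1 := by
  rw [mem_ball_zero_iff, norm_smul, hσ, mul_one]
  exact norm_ballRadius_lt_one

theorem xi_pos {z : E n} (hz : z ∈ Metric.ball (0 : E n) 1) : 0 < xi z := by
  rw [mem_ball_zero_iff] at hz
  unfold xi
  nlinarith [norm_nonneg z]

theorem exterior_subset_ball (R₀ : ℝ) : exterior n R₀ ⊆ Metric.ball (0 : E n) 1 :=
  fun _ hz => mem_ball_zero_iff.2 hz.1

theorem isOpen_exterior (R₀ : ℝ) : IsOpen (exterior n R₀) := by
  have h : ContinuousOn (areaRadius (n := n)) (Metric.ball 0 1) := by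
    refine ContinuousOn.div (by fun_prop) (by fun_prop) fun z hz => ?_
    have := xi_pos hz
    unfold xi at this
    linarith
  convert h.isOpen_inter_preimage Metric.isOpen_ball (isOpen_Ioi (a := R₀)) using 1
  ext z
  simp [exterior]

theorem contDiff_xi {m : WithTop ℕ∞} : ContDiff ℝ m (xi (n := n)) := by
  unfold xi
  exact (contDiff_const.sub (contDiff_norm_sq ℝ)).div_const 2

theorem contDiffOn_xi_sq_inv {m : WithTop ℕ∞} :
    ContDiffOn ℝ m (fun z : E n => (xi z ^ 2)⁻¹) (Metric.ball 0 1) :=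
  (contDiff_xi.pow 2).contDiffOn.inv fun _ hz => pow_ne_zero 2 (xi_pos hz).ne'

theorem contDiffOn_hypMetric {m : WithTop ℕ∞} (i j : Fin n) :
    ContDiffOn ℝ m (fun z : E n => hypMetric z i j) (Metric.ball 0 1) := by
  simp only [hypMetric, Matrix.smul_apply, smul_eq_mul]
  exact contDiffOn_xi_sq_inv.mul contDiffOn_const

theorem det_hypMetric_ne_zero {z : E n} (hz : z ∈ Metric.ball (0 : E n) 1) :
    (hypMetric z).det ≠ 0 := by
  rw [hypMetric, Matrix.det_smul, Matrix.det_one, mul_one]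
  exact pow_ne_zero _ (inv_ne_zero (pow_ne_zero 2 (xi_pos hz).ne'))

theorem continuousOn_matrix_inv {X : Type*} [TopologicalSpace X]
    {G : X → Matrix (Fin n) (Fin n) ℝ} {U : Set X}
    (hG : ∀ i j, ContinuousOn (fun z => G z i j) U) (hdet : ∀ z ∈ U, (G z).det ≠ 0)
    (i j : Fin n) : ContinuousOn (fun z => (G z)⁻¹ i j) U := by
  have h : ContinuousOn G U := continuousOn_pi.2 fun i => continuousOn_pi.2 fun j => hG i j
  have h1 : ContinuousOn (fun z => (G z).det) U := continuous_id.matrix_det.comp_continuousOn h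
  have h2 : ContinuousOn (fun z => (G z).adjugate i j) U :=
    (continuous_id.matrix_adjugate.matrix_elem i j).comp_continuousOn h
  refine ((h1.inv₀ hdet).mul h2).congr fun z _ => ?_
  simp [Matrix.inv_def, Ring.inverse_eq_inv']

theorem continuousOn_partialD {f : E n → ℝ} {U : Set (E n)} (hU : IsOpen U)
    (hf : ContDiffOn ℝ 1 f U) (i : Fin n) : ContinuousOn (partialD i f) U :=
  (hf.continuousOn_fderiv_of_isOpen hU le_rfl).clm_apply continuousOn_const

theorem continuousOn_covD_hypMetric {G : E n → Matrix (Fin n) (Fin n) ℝ} {U : Set (E n)}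
    (hU : IsOpen U) (hUb : U ⊆ Metric.ball 0 1)
    (hG : ∀ i j, ContDiffOn ℝ 1 (fun z => G z i j) U) (m i j : Fin n) :
    ContinuousOn (fun z => covD hypMetric G z m i j) U := by
  have h1 := fun i j => (hG i j).continuousOn
  have h2 := fun m i j => continuousOn_partialD hU (hG i j) m
  have h3 : ∀ m i j, ContinuousOn (fun z => christoffel hypMetric z m i j) U := by
    intro m i j
    have e1 := fun i j => (continuousOn_matrix_inv
      (fun i j => (contDiffOn_hypMetric (m := 1) i j).continuousOn)
      (fun z => det_hypMetric_ne_zero (n := n)) i j).mono hUb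
    have e2 := fun m i j => (continuousOn_partialD Metric.isOpen_ball
      (contDiffOn_hypMetric (n := n) (m := 1) i j) m).mono hUb
    unfold christoffel
    exact continuousOn_const.mul (continuousOn_finsetSum _ fun l _ =>
      (e1 m l).mul (((e2 i j l).add (e2 j i l)).sub (e2 l i j)))
  unfold covD
  exact (h2 m i j).sub (continuousOn_finsetSum _ fun l _ =>
    ((h3 l m i).mul (h1 l j)).add ((h3 l m j).mul (h1 i l)))

/-- Metric and second fundamental form of an end that are regular on all large spheres. -/
structure RegularEnd (G K : E n → Matrix (Fin n) (Fin n) ℝ) (R₀ : ℝ) : Prop where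
  contDiffOn_metric : ∀ i j, ContDiffOn ℝ 1 (fun z => G z i j) (exterior n R₀)
  continuousOn_form : ∀ i j, ContinuousOn (fun z => K z i j) (exterior n R₀)
  eventually_det_ne_zero :
    ∀ᶠ R in atTop, ∀ z, areaRadius z = R → z ∈ exterior n R₀ → (G z).det ≠ 0

theorem AsymptoticallyAdS.regularEnd {s : ℕ} (hs : 2 ≤ s) {a q : ℝ} (hq : 0 < q) {M : Type*}
    [MetricSpace M] [ChartedSpace (E n) M] [IsManifold 𝓘(ℝ, E n) ∞ M]
    [Bundle.RiemannianBundle (fun x : M => TangentSpace 𝓘(ℝ, E n) x)]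
    [IsContMDiffRiemannianBundle 𝓘(ℝ, E n) 2 (E n) (fun x : M => TangentSpace 𝓘(ℝ, E n) x)]
    [IsRiemannianManifold 𝓘(ℝ, E n) M] [CompleteSpace M] [ConnectedSpace M]
    (D : AsymptoticallyAdS n s a q M) (l : Fin D.numEnds) :
    RegularEnd (D.gEnd l) (D.kEnd l) (D.R₀ l) where
  contDiffOn_metric i j := by
    have h := (D.metric_decay l i j).1.of_le (m := 1) (by exact_mod_cast (by omega : 1 ≤ s))
    refine ((contDiffOn_xi_sq_inv.mono (exterior_subset_ball _)).mul h |>.add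
      ((contDiffOn_hypMetric i j).mono (exterior_subset_ball _))).congr fun z hz => ?_
    have := (xi_pos (exterior_subset_ball _ hz)).ne'
    field_simp
    ring
  continuousOn_form i j := by
    refine ((contDiffOn_xi_sq_inv (m := 1)).continuousOn.mono (exterior_subset_ball _) |>.mul
      (D.k_decay l i j).1.continuousOn).congr fun z hz => ?_
    exact (inv_mul_cancel_left₀ (pow_ne_zero 2 (xi_pos (exterior_subset_ball _ hz)).ne') _).symm
  eventually_det_ne_zero := by
    -- In the frame `ξ ∂_i` the metric tends uniformly to the identity matrix as the area radius
    -- grows, so its determinant is eventually nonzero on whole spheres.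
    have hlim : Tendsto (fun z => xi z ^ 2 • D.gEnd l z)
        (comap areaRadius atTop ⊓ 𝓟 (exterior n (D.R₀ l))) (𝓝 1) := by
      refine tendsto_pi_nhds.2 fun i => tendsto_pi_nhds.2 fun j => ?_
      obtain ⟨C, hC⟩ := (D.metric_decay l i j).2.1
      have h0 : Tendsto (fun z : E n => C * areaRadius z ^ (-q))
          (comap areaRadius atTop ⊓ 𝓟 (exterior n (D.R₀ l))) (𝓝 0) := by
        have := ((tendsto_rpow_neg_atTop hq).comp
          (tendsto_comap (f := areaRadius (n := n)))).const_mul C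
        rw [mul_zero] at this
        exact this.mono_left inf_le_left
      rw [tendsto_iff_norm_sub_tendsto_zero]
      refine squeeze_zero' (Eventually.of_forall fun _ => norm_nonneg _) ?_ h0
      refine eventually_inf_principal.2 (Eventually.of_forall fun z hz => ?_)
      have hr : 0 < areaRadius z := (D.R₀_pos l).trans hz.2
      -- The empty list of frame derivatives gives the zeroth-order estimate.
      have h := hC [] (Nat.zero_le s) z hz
      have hx := (xi_pos (exterior_subset_ball _ hz)).ne'
      have he : iterFrameD [] (fun z => xi z ^ 2 * (D.gEnd l z i j - hypMetric z i j)) z =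
          (xi z ^ 2 • D.gEnd l z) i j - (1 : Matrix (Fin n) (Fin n) ℝ) i j := by
        simp only [iterFrameD, List.foldr_nil, hypMetric, Matrix.smul_apply, smul_eq_mul]
        field_simp
      rw [he, ← le_div_iff₀' (Real.rpow_pos_of_pos hr q)] at h
      rwa [Real.rpow_neg hr.le, ← div_eq_mul_inv, Real.norm_eq_abs]
    have hdet : ∀ᶠ A : Matrix (Fin n) (Fin n) ℝ in 𝓝 1, A.det ≠ 0 :=
      (continuous_id.matrix_det).continuousAt.eventually_ne (by simp)
    have h := hlim.eventually hdet
    rw [eventually_inf_principal, eventually_comap] at h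
    refine h.mono fun R hR z hz hzext h0 => hR z hz hzext ?_
    rw [Matrix.det_smul, h0, mul_zero]

/-- The integrand of the flux on the unit sphere. -/
noncomputable def fluxDensity (G K : E n → Matrix (Fin n) (Fin n) ℝ) (N : E n → ℝ)
    (X : E n → Fin n → ℝ) (R : ℝ) (σ : Metric.sphere (0 : E n) 1) : ℝ :=
  (∑ i, (fluxU G N (ballRadius R • (σ : E n)) i + fluxV G K X (ballRadius R • (σ : E n)) i)
      * ((xi (ballRadius R • (σ : E n)))⁻¹ * (σ : E n) i))
    * ((xi (ballRadius R • (σ : E n)))⁻¹ ^ (n - 1) * ballRadius R ^ (n - 1))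

/-- Lapse and shift for which the flux integrals converge. -/
structure RegularLapseShift (N : E n → ℝ) (X : E n → Fin n → ℝ) : Prop where
  contDiffOn_lapse : ContDiffOn ℝ 1 N (Metric.ball 0 1)
  continuousOn_shift : ∀ i, ContinuousOn (fun z => X z i) (Metric.ball 0 1)

section

variable {G K : E n → Matrix (Fin n) (Fin n) ℝ} {R₀ : ℝ} {N N' : E n → ℝ}
  {X X' : E n → Fin n → ℝ}

theorem continuousOn_fluxU {U : Set (E n)} (hU : IsOpen U) (hUb : U ⊆ Metric.ball 0 1)
    (hG : ∀ i j, ContDiffOn ℝ 1 (fun z => G z i j) U) (hdet : ∀ z ∈ U, (G z).det ≠ 0)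
    (hN : ContDiffOn ℝ 1 N (Metric.ball 0 1)) (i : Fin n) :
    ContinuousOn (fun z => fluxU G N z i) U := by
  have h1 := fun i j => (hG i j).continuousOn
  have h2 := continuousOn_matrix_inv h1 hdet
  have h3 := continuousOn_covD_hypMetric hU hUb hG
  have h4 := hN.continuousOn.mono hUb
  have h5 := fun i => (continuousOn_partialD Metric.isOpen_ball hN i).mono hUb
  have h6 : ContinuousOn (xi (n := n)) U := (contDiff_xi (m := 1)).continuous.continuousOn
  have h7 := fun i j => (contDiffOn_hypMetric (n := n) (m := 1) i j).continuousOn.mono hUb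
  unfold fluxU
  exact (h4.mul (continuousOn_finsetSum _ fun j _ => continuousOn_finsetSum _ fun k _ =>
    continuousOn_finsetSum _ fun l _ =>
      (((h2 i k).mul (h2 j l)).sub ((h2 i j).mul (h2 k l))).mul (h3 j k l))).add
    (continuousOn_finsetSum _ fun j _ => continuousOn_finsetSum _ fun k _ =>
      ((((h6.pow 2).mul (h5 i)).mul (h2 j k)).sub (((h6.pow 2).mul (h5 j)).mul (h2 i k))).mul
        ((h1 j k).sub (h7 j k)))

theorem continuousOn_fluxV {U : Set (E n)} (hUb : U ⊆ Metric.ball 0 1)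
    (hG : ∀ i j, ContinuousOn (fun z => G z i j) U) (hdet : ∀ z ∈ U, (G z).det ≠ 0)
    (hK : ∀ i j, ContinuousOn (fun z => K z i j) U)
    (hX : ∀ i, ContinuousOn (fun z => X z i) (Metric.ball 0 1)) (i : Fin n) :
    ContinuousOn (fun z => fluxV G K X z i) U := by
  have h2 := continuousOn_matrix_inv hG hdet
  unfold fluxV traceK
  exact continuousOn_const.mul (continuousOn_finsetSum _ fun j _ =>
    ((continuousOn_finsetSum _ fun l _ => (h2 i l).mul (hK l j)).sub
      ((continuousOn_finsetSum _ fun i _ => continuousOn_finsetSum _ fun j _ =>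
        (h2 i j).mul (hK i j)).mul continuousOn_const)).mul ((hX j).mono hUb))

/-- The integrand is continuous on a compact sphere once the metric is invertible there.
Integrability is needed because the integral is additive only on integrable functions. -/
theorem RegularEnd.eventually_integrable (h : RegularEnd G K R₀) (hNX : RegularLapseShift N X) :
    ∀ᶠ R in atTop, Integrable (fluxDensity G K N X R)
      ((volume : Measure (E n)).toSphere) := by
  filter_upwards [h.eventually_det_ne_zero, eventually_ge_atTop 0, eventually_gt_atTop R₀]
    with R hdet hR0 hR
  -- An open neighbourhood of the sphere on which the inverse metric is continuous; openness makes
  -- the partial derivatives continuous as well.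
  set U : Set (E n) := exterior n R₀ ∩ (fun z => (G z).det) ⁻¹' {0}ᶜ with hUdef
  have hGc := fun i j => (h.contDiffOn_metric i j).continuousOn
  have hGm : ContinuousOn G (exterior n R₀) :=
    continuousOn_pi.2 fun i => continuousOn_pi.2 fun j => hGc i j
  have hUo : IsOpen U := (continuous_id.matrix_det.comp_continuousOn hGm).isOpen_inter_preimage
    (isOpen_exterior R₀) isOpen_compl_singleton
  have hUe : U ⊆ exterior n R₀ := Set.inter_subset_left
  have hUb : U ⊆ Metric.ball 0 1 := hUe.trans (exterior_subset_ball R₀)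
  have hUd : ∀ z ∈ U, (G z).det ≠ 0 := fun z hz => hz.2
  have hmem : ∀ σ : Metric.sphere (0 : E n) 1, ballRadius R • (σ : E n) ∈ U := by
    intro σ
    have hσ : ‖(σ : E n)‖ = 1 := mem_sphere_zero_iff_norm.1 σ.2
    have har := areaRadius_ballRadius_smul hR0 hσ
    have he : ballRadius R • (σ : E n) ∈ exterior n R₀ :=
      ⟨mem_ball_zero_iff.1 (ballRadius_smul_mem_ball R hσ), by rwa [har]⟩
    exact ⟨he, hdet _ har he⟩
  have hcont : Continuous fun σ : Metric.sphere (0 : E n) 1 => ballRadius R • (σ : E n) := by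
    fun_prop
  have hu := fun i => (continuousOn_fluxU hUo hUb (fun i j => (h.contDiffOn_metric i j).mono hUe)
    hUd hNX.contDiffOn_lapse i).comp_continuous hcont hmem
  have hv := fun i => (continuousOn_fluxV hUb (fun i j => (hGc i j).mono hUe) hUd
    (fun i j => (h.continuousOn_form i j).mono hUe) hNX.continuousOn_shift i).comp_continuous
    hcont hmem
  have hx : Continuous fun σ : Metric.sphere (0 : E n) 1 => (xi (ballRadius R • (σ : E n)))⁻¹ :=
    ((contDiff_xi (m := 1)).continuous.comp hcont).inv₀ fun σ => (xi_pos (hUb (hmem σ))).ne'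
  have hc : Continuous (fluxDensity G K N X R) := by
    unfold fluxDensity
    exact (continuous_finsetSum _ fun i _ => ((hu i).add (hv i)).mul
      (hx.mul (by fun_prop))).mul ((hx.pow _).mul continuous_const)
  exact hc.integrable_of_hasCompactSupport (HasCompactSupport.of_compactSpace _)

theorem partialD_congr (h : Set.EqOn N N' (Metric.ball 0 1)) {z : E n}
    (hz : z ∈ Metric.ball (0 : E n) 1) (i : Fin n) : partialD i N z = partialD i N' z := by
  rw [partialD, partialD, (h.eventuallyEq_of_mem (Metric.isOpen_ball.mem_nhds hz)).fderiv_eq]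

theorem partialD_linear (hN : ContDiffOn ℝ 1 N (Metric.ball 0 1))
    (hN' : ContDiffOn ℝ 1 N' (Metric.ball 0 1)) (a b : ℝ) {z : E n}
    (hz : z ∈ Metric.ball (0 : E n) 1) (i : Fin n) :
    partialD i (fun z => a * N z + b * N' z) z = a * partialD i N z + b * partialD i N' z := by
  have h1 := (hN.differentiableOn one_ne_zero).differentiableAt (Metric.isOpen_ball.mem_nhds hz)
  have h2 := (hN'.differentiableOn one_ne_zero).differentiableAt (Metric.isOpen_ball.mem_nhds hz)
  have := ((h1.hasFDerivAt.const_mul a).add (h2.hasFDerivAt.const_mul b)).fderiv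
  rw [partialD, partialD, partialD]
  erw [this]
  simp

/-- All the spheres lie in the open unit ball, where agreement of the lapses includes that of their
derivatives. The formulas for the currents of Killing spinors are available only there. -/
theorem HasMass.congr {m : ℝ} (h : HasMass G K N X m) (hN : Set.EqOn N N' (Metric.ball 0 1))
    (hX : Set.EqOn X X' (Metric.ball 0 1)) : HasMass G K N' X' m := by
  have : flux G K N X = flux G K N' X' := by
    funext R
    unfold flux
    congr 2
    funext σ
    have hz := ballRadius_smul_mem_ball R (mem_sphere_zero_iff_norm.1 σ.2)
    unfold fluxU fluxV
    simp only [hN hz, hX hz, partialD_congr hN hz]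
  unfold HasMass at h ⊢
  rwa [← this]

theorem RegularLapseShift.linear (h : RegularLapseShift N X) (h' : RegularLapseShift N' X')
    (a b : ℝ) : RegularLapseShift (fun z => a * N z + b * N' z)
      (fun z i => a * X z i + b * X' z i) where
  contDiffOn_lapse := (contDiffOn_const.mul h.contDiffOn_lapse).add
    (contDiffOn_const.mul h'.contDiffOn_lapse)
  continuousOn_shift i := (continuousOn_const.mul (h.continuousOn_shift i)).add
    (continuousOn_const.mul (h'.continuousOn_shift i))

theorem fluxDensity_linear (h : RegularLapseShift N X) (h' : RegularLapseShift N' X')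
    (a b R : ℝ) (σ : Metric.sphere (0 : E n) 1) :
    fluxDensity G K (fun z => a * N z + b * N' z) (fun z i => a * X z i + b * X' z i) R σ =
      a * fluxDensity G K N X R σ + b * fluxDensity G K N' X' R σ := by
  have hz := ballRadius_smul_mem_ball R (mem_sphere_zero_iff_norm.1 σ.2)
  have hU : ∀ i, fluxU G (fun z => a * N z + b * N' z) (ballRadius R • (σ : E n)) i =
      a * fluxU G N (ballRadius R • (σ : E n)) i
        + b * fluxU G N' (ballRadius R • (σ : E n)) i := by
    intro i
    simp only [fluxU, partialD_linear h.contDiffOn_lapse h'.contDiffOn_lapse a b hz]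
    rw [mul_add a, mul_add b, add_add_add_comm]
    congr 1
    · ring
    · simp only [Finset.mul_sum, ← Finset.sum_add_distrib]
      exact Finset.sum_congr rfl fun j _ => Finset.sum_congr rfl fun k _ => by ring
  have hV : ∀ i, fluxV G K (fun z i => a * X z i + b * X' z i) (ballRadius R • (σ : E n)) i =
      a * fluxV G K X (ballRadius R • (σ : E n)) i
        + b * fluxV G K X' (ballRadius R • (σ : E n)) i := by
    intro i
    simp only [fluxV]
    rw [mul_left_comm a, mul_left_comm b, ← mul_add]
    congr 1
    simp only [Finset.mul_sum _ _ a, Finset.mul_sum _ _ b, ← Finset.sum_add_distrib]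
    exact Finset.sum_congr rfl fun j _ => by ring
  simp only [fluxDensity, hU, hV]
  rw [← mul_assoc, ← mul_assoc a, ← mul_assoc b, Finset.mul_sum, Finset.mul_sum, ← mul_assoc,
    ← mul_assoc, ← add_mul, ← add_mul, ← Finset.sum_add_distrib]
  congr 2
  exact Finset.sum_congr rfl fun j _ => by ring

theorem HasMass.linear (hE : RegularEnd G K R₀) {m m' : ℝ} (hm : HasMass G K N X m)
    (hm' : HasMass G K N' X' m') (h : RegularLapseShift N X) (h' : RegularLapseShift N' X')
    (a b : ℝ) : HasMass G K (fun z => a * N z + b * N' z) (fun z i => a * X z i + b * X' z i)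
      (a * m + b * m') := by
  refine ((hm.const_mul a).add (hm'.const_mul b)).congr' ?_
  filter_upwards [hE.eventually_integrable h, hE.eventually_integrable h'] with R i1 i2
  have : ∫ σ, fluxDensity G K (fun z => a * N z + b * N' z) (fun z i => a * X z i + b * X' z i) R σ
      ∂((volume : Measure (E n)).toSphere) =
      a * ∫ σ, fluxDensity G K N X R σ ∂((volume : Measure (E n)).toSphere) +
      b * ∫ σ, fluxDensity G K N' X' R σ ∂((volume : Measure (E n)).toSphere) := by
    rw [← integral_const_mul, ← integral_const_mul,
      ← integral_add (i1.const_mul a) (i2.const_mul b)]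
    exact integral_congr_ae (ae_of_all _ fun σ => fluxDensity_linear h h' a b R σ)
  unfold fluxDensity at this
  unfold flux
  rw [this]
  ring

theorem RegularLapseShift.zero :
    RegularLapseShift (fun _ : E n => 0) (fun _ _ => 0) where
  contDiffOn_lapse := contDiffOn_const
  continuousOn_shift _ := continuousOn_const

theorem hasMass_zero : HasMass G K (fun _ => 0) (fun _ _ => 0) 0 := by
  have : flux G K (fun _ => 0) (fun _ _ => 0) = fun _ => 0 := by
    funext R
    have h0 : ∀ (i : Fin n) (z : E n), partialD i (fun _ => (0 : ℝ)) z = 0 := by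
      intro i z
      simp [partialD]
    simp [flux, fluxU, fluxV, h0]
  unfold HasMass
  rw [this]
  exact tendsto_const_nhds

theorem HasMass.sum (hE : RegularEnd G K R₀) {ι : Type*} (s : Finset ι) {N : ι → E n → ℝ}
    {X : ι → E n → Fin n → ℝ} {m : ι → ℝ} (hm : ∀ i, HasMass G K (N i) (X i) (m i))
    (h : ∀ i, RegularLapseShift (N i) (X i)) (a : ι → ℝ) :
    HasMass G K (fun z => ∑ i ∈ s, a i * N i z) (fun z j => ∑ i ∈ s, a i * X i z j)
        (∑ i ∈ s, a i * m i) ∧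
      RegularLapseShift (fun z => ∑ i ∈ s, a i * N i z) (fun z j => ∑ i ∈ s, a i * X i z j) := by
  classical
  induction s using Finset.induction_on with
  | empty => simpa using ⟨hasMass_zero, RegularLapseShift.zero⟩
  | insert i s hi ih =>
    simp only [Finset.sum_insert hi]
    have h1 := (hm i).linear hE ih.1 (h i) ih.2 (a i) 1
    have h2 := (h i).linear ih.2 (a i) 1
    simp only [one_mul] at h1 h2
    exact ⟨h1, h2⟩

end

end Flux
end AdS

namespace AdS
-- The mass functional as a quadratic form in the constant spinor.
section SpinorMass

variable {n : ℕ} {S : Type*} [NormedAddCommGroup S] [InnerProductSpace ℂ S]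

theorem killingSpinor_eq_apply (c : SpinorModule n S) (u : DoubleSpinor S) (z : E n) :
    killingSpinor c u z =
      (((xi z ^ (-(1 / 2) : ℝ) : ℝ) : ℂ) • (1 - Complex.I • spaceOp c z)) u := rfl

theorem isSymmetric_one_sub_I_spaceOp (c : SpinorModule n S) (z : E n) :
    (1 - Complex.I • spaceOp c z).IsSymmetric :=
  LinearMap.IsSymmetric.sub LinearMap.IsSymmetric.one (isSymmetric_I_spaceOp c z)

/-- The operator `1 - 𝐢 z` is symmetric, so it can be moved onto `T` from both sides; the two
factors `ξ^{-1/2}` combine to `ξ⁻¹`. -/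
theorem expect_killingSpinor (c : SpinorModule n S) (T : Module.End ℂ (DoubleSpinor S))
    (u : DoubleSpinor S) {z : E n} (hz : z ∈ Metric.ball (0 : E n) 1) :
    expect T (killingSpinor c u z) = (xi z)⁻¹ *
      expect ((1 - Complex.I • spaceOp c z) * T * (1 - Complex.I • spaceOp c z)) u := by
  have hxi := xi_pos hz
  have hsq : xi z ^ (-(1 / 2) : ℝ) * xi z ^ (-(1 / 2) : ℝ) = (xi z)⁻¹ := by
    rw [← Real.rpow_add hxi, ← Real.rpow_neg_one]
    norm_num
  rw [killingSpinor_eq_apply,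
    expect_conj (isSymmetric_real_smul (isSymmetric_one_sub_I_spaceOp c z) _), smul_mul_assoc,
    smul_mul_assoc, mul_smul_comm, smul_smul, ← Complex.ofReal_mul, hsq, expect_smul]

theorem one_sub_I_spaceOp_mul_self (c : SpinorModule n S) (z : E n) :
    (1 - Complex.I • spaceOp c z) * 1 * (1 - Complex.I • spaceOp c z) =
      ((1 + ‖z‖ ^ 2 : ℝ) : ℂ) • 1 + ∑ i, ((-2 * z i : ℝ) : ℂ) •
        (Complex.I • spaceOp c (stdVec i)) := by
  have h : ∑ i, ((-2 * z i : ℝ) : ℂ) • (Complex.I • spaceOp c (stdVec i)) =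
      (-2 : ℂ) • (Complex.I • spaceOp c z) := by
    rw [spaceOp_eq_sum c z, Finset.smul_sum, Finset.smul_sum]
    refine Finset.sum_congr rfl fun i _ => ?_
    push_cast
    module
  rw [h, mul_one, mul_sub, mul_one, sub_mul, one_mul, I_spaceOp_mul_self]
  push_cast
  module

theorem currentN_killingSpinor (c : SpinorModule n S) (u : DoubleSpinor S) {z : E n}
    (hz : z ∈ Metric.ball (0 : E n) 1) : currentN (killingSpinor c u z) =
      ‖u‖ ^ 2 * (2 / (1 - ‖z‖ ^ 2) * (1 + ‖z‖ ^ 2)) +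
        ∑ i, currentY c u i * (-2 * (2 / (1 - ‖z‖ ^ 2) * z i)) := by
  rw [currentN_eq_expect, expect_killingSpinor c _ u hz, one_sub_I_spaceOp_mul_self, expect_add,
    expect_smul, expect_one, expect_sum, mul_add, Finset.mul_sum]
  have hx : (xi z)⁻¹ = 2 / (1 - ‖z‖ ^ 2) := by rw [xi, inv_div]
  rw [hx]
  congr 1
  · ring
  · refine Finset.sum_congr rfl fun i _ => ?_
    rw [expect_smul, ← currentY_apply]
    ring

theorem stdVec_inner (j : Fin n) (z : E n) : inner ℝ (stdVec j) z = z j := by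
  simp [stdVec, EuclideanSpace.inner_single_left]

/-- Both `rotGen` and its coefficients are antisymmetric in the pair, so the two halves of the sum
agree and cancel the factor `1/2` in `rotGen`. -/
theorem sum_rotGen (c : SpinorModule n S) (z : E n) (j : Fin n) :
    ∑ p : Fin n × Fin n, ((z p.1 * (if j = p.2 then 1 else 0)
        - z p.2 * (if j = p.1 then 1 else 0) : ℝ) : ℂ) • rotGen c p.1 p.2 =
      Complex.I • ((spaceOp c (stdVec j) * spaceOp c z - spaceOp c z * spaceOp c (stdVec j))
        * timeOp S) := by
  have hanti : ∀ i k, rotGen c i k = -rotGen c k i := by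
    intro i k
    rw [rotGen, rotGen, ← smul_neg, ← neg_mul, neg_sub]
  rw [Fintype.sum_prod_type]
  simp only [Complex.ofReal_sub, sub_smul, Finset.sum_sub_distrib]
  have h1 : ∑ a, ∑ b, ((z a * (if j = b then 1 else 0) : ℝ) : ℂ) • rotGen c a b =
      ∑ a, (z a : ℂ) • rotGen c a j := by
    refine Finset.sum_congr rfl fun a _ => ?_
    rw [Finset.sum_eq_single j]
    · simp
    · intro b _ hb
      simp [hb.symm]
    · simp
  have h2 : ∑ a, ∑ b, ((z b * (if j = a then 1 else 0) : ℝ) : ℂ) • rotGen c a b =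
      -∑ a, (z a : ℂ) • rotGen c a j := by
    rw [Finset.sum_eq_single j]
    · rw [← Finset.sum_neg_distrib]
      refine Finset.sum_congr rfl fun b _ => ?_
      rw [hanti]
      simp
    · intro b _ hb
      simp [hb.symm]
    · simp
  rw [h1, h2, sub_neg_eq_add, ← Finset.sum_add_distrib, spaceOp_eq_sum c z, Finset.mul_sum,
    Finset.sum_mul, ← Finset.sum_sub_distrib, Finset.sum_mul, Finset.smul_sum]
  refine Finset.sum_congr rfl fun a _ => ?_
  rw [rotGen, mul_smul_comm, smul_mul_assoc, ← smul_sub, smul_mul_assoc]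
  module

/-- The terms of order zero and two in `z` give the shifts of the center of mass, through `z e_j z =
|z|² e_j - 2 z_j z`. The term of order one is the commutator `𝐢 (e_j z - z e_j) e₀`, which gives the
rotations. -/
theorem one_sub_I_spaceOp_conj (c : SpinorModule n S) (z : E n) (j : Fin n) :
    (1 - Complex.I • spaceOp c z) * (spaceOp c (stdVec j) * timeOp S)
        * (1 - Complex.I • spaceOp c z) =
      (∑ i, (((1 + ‖z‖ ^ 2) * (if j = i then 1 else 0) - 2 * z i * z j : ℝ) : ℂ) •
        (spaceOp c (stdVec i) * timeOp S)) +
      ∑ p : Fin n × Fin n, ((z p.1 * (if j = p.2 then 1 else 0)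
        - z p.2 * (if j = p.1 then 1 else 0) : ℝ) : ℂ) • rotGen c p.1 p.2 := by
  have h1 : ∑ i, (((1 + ‖z‖ ^ 2) * (if j = i then 1 else 0) - 2 * z i * z j : ℝ) : ℂ) •
        (spaceOp c (stdVec i) * timeOp S) =
      ((1 + ‖z‖ ^ 2 : ℝ) : ℂ) • (spaceOp c (stdVec j) * timeOp S)
        - ((2 * z j : ℝ) : ℂ) • (spaceOp c z * timeOp S) := by
    rw [spaceOp_eq_sum c z, Finset.sum_mul, Finset.smul_sum]
    simp only [Complex.ofReal_sub, sub_smul, Finset.sum_sub_distrib]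
    congr 1
    · rw [Finset.sum_eq_single j]
      · simp
      · intro b _ hb
        simp [hb.symm]
      · simp
    · refine Finset.sum_congr rfl fun i _ => ?_
      rw [smul_mul_assoc]
      push_cast
      module
  rw [sum_rotGen, h1]
  have ht := timeOp_mul_spaceOp c z
  have hs := spaceOp_mul_self c z
  have ha := spaceOp_anticomm c (stdVec j) z
  rw [stdVec_inner, ← eq_sub_iff_add_eq] at ha
  generalize spaceOp c z = W at *
  generalize spaceOp c (stdVec j) = V at *
  have e1 : V * timeOp S * W = -(V * W * timeOp S) := by
    rw [mul_assoc, ht, mul_neg, ← mul_assoc]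
  have e2 : W * (V * timeOp S) * W =
      -((((‖z‖ ^ 2 : ℝ) : ℂ) • V - ((2 * z j : ℝ) : ℂ) • W) * timeOp S) := by
    have e3 : W * (V * W) = ((‖z‖ ^ 2 : ℝ) : ℂ) • V - ((2 * z j : ℝ) : ℂ) • W := by
      rw [ha, mul_sub, ← mul_assoc, hs, mul_neg, mul_smul_comm, mul_one, neg_mul, smul_mul_assoc,
        one_mul]
      abel
    rw [mul_assoc, e1, mul_neg, ← mul_assoc, e3]
  rw [sub_mul, one_mul, mul_sub, mul_one, sub_mul, smul_mul_assoc, mul_smul_comm, smul_mul_assoc,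
    mul_smul_comm, smul_smul, Complex.I_mul_I, e1, e2, sub_mul, sub_mul, ← mul_assoc,
    smul_mul_assoc, smul_mul_assoc]
  push_cast
  module

theorem xi_mul_currentX_killingSpinor (c : SpinorModule n S) (u : DoubleSpinor S) {z : E n}
    (hz : z ∈ Metric.ball (0 : E n) 1) (j : Fin n) :
    xi z * currentX c (killingSpinor c u z) j =
      (∑ i, currentX c u i * ((1 + ‖z‖ ^ 2) * (if j = i then 1 else 0) - 2 * z i * z j)) +
      ∑ p : Fin n × Fin n, expect (rotGen c p.1 p.2) u *
        (z p.1 * (if j = p.2 then 1 else 0) - z p.2 * (if j = p.1 then 1 else 0)) := by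
  rw [currentX_apply, expect_killingSpinor c _ u hz, ← mul_assoc,
    mul_inv_cancel₀ (xi_pos hz).ne', one_mul, one_sub_I_spaceOp_conj, expect_add, expect_sum,
    expect_sum]
  congr 1
  · refine Finset.sum_congr rfl fun i _ => ?_
    rw [expect_smul, ← currentX_apply, mul_comm]
  · refine Finset.sum_congr rfl fun p _ => ?_
    rw [expect_smul, mul_comm]

/-- The endomorphism whose quadratic form is the mass functional. -/
noncomputable def massOp (c : SpinorModule n S) (energy : ℝ) (linMom center : E n)
    (angMom : Matrix (Fin n) (Fin n) ℝ) : Module.End ℂ (DoubleSpinor S) :=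
  (energy : ℂ) • 1 + (Complex.I • spaceOp c linMom + spaceOp c center * timeOp S
    + ∑ i, ∑ j, (angMom i j : ℂ) • rotGen c i j)

theorem HasCharges.hasSpinorMass {G K : E n → Matrix (Fin n) (Fin n) ℝ} {R₀ energy : ℝ}
    {linMom center : E n} {angMom : Matrix (Fin n) (Fin n) ℝ} (hE : RegularEnd G K R₀)
    (h : HasCharges G K energy linMom center angMom) (c : SpinorModule n S)
    (u : DoubleSpinor S) :
    HasSpinorMass c G K u (expect (massOp c energy linMom center angMom) u) := by
  have hd : ContDiffOn ℝ 1 (fun z : E n => 2 / (1 - ‖z‖ ^ 2)) (Metric.ball 0 1) := by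
    refine contDiffOn_const.div (contDiff_const.sub (contDiff_norm_sq ℝ)).contDiffOn
      fun z hz => ?_
    have := xi_pos hz
    unfold xi at this
    linarith
  have hz : ∀ i, ContDiffOn ℝ 1 (fun z : E n => z i) (Metric.ball 0 1) := fun i =>
    (EuclideanSpace.proj (𝕜 := ℝ) i).contDiff.contDiffOn
  have r1 : RegularLapseShift (fun z : E n => 2 / (1 - ‖z‖ ^ 2) * (1 + ‖z‖ ^ 2))
      (fun _ _ => 0) :=
    ⟨hd.mul (contDiff_const.add (contDiff_norm_sq ℝ)).contDiffOn, fun _ => continuousOn_const⟩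
  have r2 : ∀ i, RegularLapseShift (fun z : E n => -2 * (2 / (1 - ‖z‖ ^ 2) * z i))
      (fun _ _ => 0) := fun i =>
    ⟨contDiffOn_const.mul (hd.mul (hz i)), fun _ => continuousOn_const⟩
  have r3 : ∀ i, RegularLapseShift (fun _ : E n => 0)
      (fun z k => (1 + ‖z‖ ^ 2) * (if k = i then 1 else 0) - 2 * z i * z k) := fun i =>
    ⟨contDiffOn_const, fun k => by fun_prop⟩
  have r4 : ∀ p : Fin n × Fin n, RegularLapseShift (fun _ : E n => 0)
      (fun z k => z p.1 * (if k = p.2 then 1 else 0) - z p.2 * (if k = p.1 then 1 else 0)) :=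
    fun p => ⟨contDiffOn_const, fun k => by fun_prop⟩
  obtain ⟨m2, s2⟩ := HasMass.sum hE Finset.univ h.hasLinMom r2 (currentY c u)
  obtain ⟨m3, s3⟩ := HasMass.sum hE Finset.univ h.hasCenter r3 (currentX c u)
  -- The sum runs over ordered pairs, in agreement with the double sum in `massOp`.
  obtain ⟨m4, s4⟩ := HasMass.sum hE Finset.univ (fun p : Fin n × Fin n => h.hasAngMom p.1 p.2) r4
    (fun p => expect (rotGen c p.1 p.2) u)
  have m12 := h.hasEnergy.linear hE m2 r1 s2 (‖u‖ ^ 2) 1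
  have m34 := m3.linear hE m4 s3 s4 1 1
  have m := m12.linear hE m34 (r1.linear s2 _ _) (s3.linear s4 _ _) 1 1
  have hval : expect (massOp c energy linMom center angMom) u =
      1 * (‖u‖ ^ 2 * energy + 1 * ∑ i, currentY c u i * linMom i) +
      1 * (1 * ∑ i, currentX c u i * center i +
        1 * ∑ p : Fin n × Fin n, expect (rotGen c p.1 p.2) u * angMom p.1 p.2) := by
    rw [massOp, expect_add, expect_add, expect_add, expect_smul, expect_one, ← inner_currentX,
      ← inner_currentY, expect_sum, PiLp.inner_apply, PiLp.inner_apply, Fintype.sum_prod_type]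
    simp only [expect_sum, expect_smul, mul_comm (expect _ _)]
    simp
    ring
  rw [HasSpinorMass, hval]
  refine m.congr (fun z hz => ?_) (fun z hz => funext fun j => ?_)
  · simp only [currentN_killingSpinor c u hz]
    simp
  · simp only [xi_mul_currentX_killingSpinor c u hz]
    simp

end SpinorMass
end AdS

/-! ### The theorem. -/

theorem mainTheorem11 (n s : ℕ) (hn : 2 ≤ n) (hs : 2 ≤ s) (a q : ℝ)
    (ha : 0 < a ∧ a < 1) (hq : (n : ℝ) / 2 < q ∧ q ≤ n)
    (M : Type*) [MetricSpace M] [ChartedSpace (AdS.E n) M] [IsManifold 𝓘(ℝ, AdS.E n) ∞ M]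
    [Bundle.RiemannianBundle (fun x : M => TangentSpace 𝓘(ℝ, AdS.E n) x)]
    [IsContMDiffRiemannianBundle 𝓘(ℝ, AdS.E n) 2 (AdS.E n)
      (fun x : M => TangentSpace 𝓘(ℝ, AdS.E n) x)]
    [IsRiemannianManifold 𝓘(ℝ, AdS.E n) M] [CompleteSpace M] [ConnectedSpace M]
    (D : AdS.AsymptoticallyAdS n s a q M) (l : Fin D.numEnds)
    (S : Type*) [NormedAddCommGroup S] [InnerProductSpace ℂ S] (c : AdS.SpinorModule n S)
    (energy : ℝ) (linMom center : AdS.E n) (angMom : Matrix (Fin n) (Fin n) ℝ)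
    (hcharges : AdS.HasCharges (D.gEnd l) (D.kEnd l) energy linMom center angMom)
    (hcase : angMom = 0 ∨ (AdS.IsSimple angMom ∧ center = 0) ∨
      (AdS.IsSimple angMom ∧ linMom = 0)) :
    ∃ u : AdS.DoubleSpinor S, u ≠ 0 ∧
      AdS.IsImaginaryKilling c (AdS.killingSpinor c u) ∧
      (∀ z : AdS.E n, ‖z‖ < 1 →
        AdS.IsNull c (AdS.killingSpinor c u z) ∧ AdS.IsTypeI c (AdS.killingSpinor c u z)) ∧
      AdS.IsMassMinimizing c (D.gEnd l) (D.kEnd l) u := by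
  have hmin : AdS.MinimizedByFixed c (Complex.I • AdS.spaceOp c linMom
      + AdS.spaceOp c center * AdS.timeOp S + ∑ i, ∑ j, (angMom i j : ℂ) • AdS.rotGen c i j) := by
    rcases hcase with rfl | ⟨⟨b, e, f, he, hf, hef, hA⟩, rfl⟩ | ⟨⟨b, e, f, he, hf, hef, hA⟩, rfl⟩
    · simpa using AdS.minimizedByFixed_vectors hn c linMom center
    · simp only [hA, AdS.sum_wedge_rotGen c hef, AdS.spaceOp_zero, zero_mul, add_zero]
      exact AdS.minimizedByFixed_linMom_simple c linMom he hf hef _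
    · simp only [hA, AdS.sum_wedge_rotGen c hef, AdS.spaceOp_zero, smul_zero, zero_add]
      exact AdS.minimizedByFixed_center_simple c center he hf hef _
  obtain ⟨x, y, hx, hy, hxy, m, hle, heq⟩ := hmin
  obtain ⟨u, hu, hxu, hyu⟩ := AdS.exists_fixed_spinor c hx hy hxy
  have hn' : (2 : ℝ) ≤ n := by exact_mod_cast hn
  have hmass := hcharges.hasSpinorMass (D.regularEnd hs (by linarith [hq.1]) l) c
  refine ⟨u, hu, AdS.isImaginaryKilling_killingSpinor c u,
    fun z hz => AdS.killingSpinor_null_typeI c hx hy hxu hyu hz, _, hmass u,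
    fun v hv => ⟨_, hmass v, ?_⟩⟩
  -- The energy contributes `𝓔 |v|²`, the same for all competitors, so only the remaining operator
  -- has to be compared.
  rw [AdS.massOp, AdS.expect_add _ (_ + _ + _), AdS.expect_add _ (_ + _ + _), heq u hxu hyu,
    AdS.expect_smul, AdS.expect_smul, AdS.expect_one, AdS.expect_one, hv]
  have := hle v
  rw [hv] at this
  linarith
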